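/- Let $T=(T_1,\dots,T_d)$ be a row contraction on a complex Hilbert space $\mathcal X$: bounded, not necessarily commuting operators such that the block row $T=[T_1\ \cdots\ T_d]:\mathcal X^d\to\mathcal X$ is a contraction. Put $D_T=(I-T^*T)^{1/2}$, $D_{T^*}=(I-TT^*)^{1/2}$, $\mathcal D_T=\overline{\operatorname{Ran}}\,D_T\subset\mathcal X^d$, $\mathcal D_{T^*}=\overline{\operatorname{Ran}}\,D_{T^*}\subset\mathcal X$, let $I_k:\mathcal X\to\mathcal X^d$ be the inclusion into the $k$-th slot, and let $Z(\mathbf z)=[\mathbf z_1I\ \cdots\ \mathbf z_dI]$, where $\mathbf z_1,\dots,\mathbf z_d$ are freely noncommuting indeterminates; let $\zeta_1,\dots,\zeta_d$ be a second such set, commuting with the $\mathbf z_i$. Formal adjoints are $(\sum_v H_v\mathbf z^v)^*=\sum_v H_v^*\mathbf z^{v^\top}$, where $v^\top$ is the reversed word; in particular $Z(\mathbf z)^*$ is the column with entries $\mathbf z_iI$. The noncommutative characteristic function of $T$ is the formal power series $$\theta_{T,nc}(\mathbf z)=\bigl(-T+D_{T^*}(I-Z(\mathbf z)T^*)^{-1}Z(\mathbf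 z)D_T\bigr)\big|_{\mathcal D_T}$$ with coefficients in $\mathcal L(\mathcal D_T,\mathcal D_{T^*})$. Let $\mathbb K_{T,nc}(\mathbf z,\zeta)=G(\mathbf z)G(\zeta)^*$, a formal kernel with coefficients in $\mathcal L(\mathcal D_{T^*}\oplus\mathcal D_T^d)$, where $G(\mathbf z)$ is the column with entries $D_{T^*}(I-Z(\mathbf z)T^*)^{-1}$ and $D_T(I-Z(\mathbf z)^*T)^{-1}I_k$, $k=1,\dots,d$. A *noncommutative Agler decomposition* of a formal power series $S$ with coefficients in $\mathcal L(\mathcal U,\mathcal Y)$ is a formal kernel $\mathbb K$ with coefficients in $\mathcal L(\mathcal Y\oplus\mathcal U^d)$ that is positive (that is, $\mathbb K=H(\mathbf z)H(\zeta)^*$ for some formal power series $H$ with operator coefficients), whose $(1,1)$ block $K$, remaining first-row blocks $\Psi_k$ and lower diagonal blocks $\Phi_{ij}$ satisfy, with $k_{Sz}(\mathbf z,\zeta)=\sum_\alpha\mathbf z^\alpha\zeta^{\alpha^\top}$, $$K(\mathbf z,\zeta)=k_{Sz}(\mathbf z,\zeta)I_{\mathcal Y}-S(\mathbf z)\bigl(k_{Sz}(\mathbf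 z,\zeta)I_{\mathcal U}\bigr)S(\zeta)^*,\qquad S(\mathbf z)-S(\zeta)=\sum_k\bigl[\Psi_k(\mathbf z,\zeta)\mathbf z_k-\zeta_k\Psi_k(\mathbf z,\zeta)\bigr],$$ $$I-S(\mathbf z)^*S(\zeta)=\sum_k\Phi_{kk}(\mathbf z,\zeta)-\sum_{i,j}\zeta_j\Phi_{ij}(\mathbf z,\zeta)\mathbf z_i.$$ $T$ is *completely nonunitary* if there is no nonzero closed subspace $\mathcal M$ reducing for every $T_i$ such that $P_{\mathcal M}[T_1|_{\mathcal M}\ \cdots\ T_d|_{\mathcal M}]:\mathcal M^d\to\mathcal M$ is unitary. **Theorem.** Let $T$ and $R$ be completely nonunitary row contractions ($d$-tuples) on complex Hilbert spaces $\mathcal X$ and $\mathcal X'$. Then $\mathbb K_{T,nc}$ and $\mathbb K_{R,nc}$ are noncommutative Agler decompositions of $\theta_{T,nc}$ and $\theta_{R,nc}$, respectively, and the following are equivalent: 1. $T$ and $R$ are unitarily equivalent: there is a unitary $V:\mathcal X\to\mathcal X'$ with $VT_iV^*=R_i$ for $i=1,\dots,d$; 2. the pairs $(\theta_{T,nc},\mathbb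 K_{T,nc})$ and $(\theta_{R,nc},\mathbb K_{R,nc})$ jointly coincide: there are unitary operators $a:\mathcal D_{R^*}\to\mathcal D_{T^*}$ and $b:\mathcal D_R\to\mathcal D_T$ such that $$\theta_{T,nc}(\mathbf z)=a\,\theta_{R,nc}(\mathbf z)\,b^*,\qquad \mathbb K_{T,nc}(\mathbf z,\zeta)=(a\oplus b^{\oplus d})\,\mathbb K_{R,nc}(\mathbf z,\zeta)\,(a\oplus b^{\oplus d})^*.$$ -/

import Mathlib

open scoped InnerProduct

noncomputable section

namespace NCAgler

universe u v w

/-! ### Direct sums and words -/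

/-- The Hilbert space direct sum `X^d`. -/
abbrev DirectPow (d : ℕ) (X : Type u) : Type u := PiLp 2 (fun _ : Fin d => X)

/-- The Hilbert space direct sum `Y ⊕ U^d`. -/
abbrev BlockSpace (d : ℕ) (Y : Type u) (U : Type v) : Type (max u v) :=
  WithLp 2 (Y × DirectPow d U)

/-- Elements of the free semigroup on `d` letters.  The word `i_N ⋯ i_1` is the list
`[i_N, …, i_1]`, concatenation is `++`, the empty word is `[]` and the transpose is
`List.reverse`. -/
abbrev Word (d : ℕ) : Type := List (Fin d)

section Operators

variable {d : ℕ}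
variable {X : Type u} [NormedAddCommGroup X] [InnerProductSpace ℂ X]
variable {Y : Type v} [NormedAddCommGroup Y] [InnerProductSpace ℂ Y]

/-- The projection of `X^d` onto its `i`-th coordinate; its adjoint is the inclusion of `X` into
the `i`-th slot. -/
def coord (d : ℕ) (X : Type u) [NormedAddCommGroup X] [InnerProductSpace ℂ X] (i : Fin d) :
    DirectPow d X →L[ℂ] X :=
  PiLp.proj 2 (fun _ : Fin d => X) i

/-- The block row operator `[A_1 ⋯ A_d] : X^d → Y`. -/
def rowOp (A : Fin d → X →L[ℂ] Y) : DirectPow d X →L[ℂ] Y :=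
  ∑ i, A i ∘L coord d X i

/-- The product `M_{i_N} ⋯ M_{i_1}` for the word `v = i_N ⋯ i_1`, the identity for the empty word.
In other words, `wordPow M v` is the coefficient of `z^v` in the noncommutative formal power series
`(I - z_1 M_1 - ⋯ - z_d M_d)⁻¹`. -/
def wordPow (M : Fin d → X →L[ℂ] X) (v : Word d) : X →L[ℂ] X :=
  (v.map M).prod

/-- A bounded operator between Hilbert spaces is unitary. -/
def IsUnitaryOp (A : X →L[ℂ] Y) : Prop :=
  ∃ W : X ≃ₗᵢ[ℂ] Y, ∀ x, W x = A x

variable [CompleteSpace X] [CompleteSpace Y]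

/-- The defect operator `D_A = (I - A* A)^{1/2}` of a contraction `A : X → Y`. -/
def defectOp (A : X →L[ℂ] Y) : X →L[ℂ] X := CFC.sqrt (1 - A† ∘L A)

/-- The defect space of `A : X → Y`, the closure of the range of `D_A`. -/
def defectSpace (A : X →L[ℂ] Y) : Submodule ℂ X :=
  (LinearMap.range (defectOp A).toLinearMap).topologicalClosure

instance (A : X →L[ℂ] Y) : CompleteSpace (defectSpace A) :=
  inferInstanceAs
    (CompleteSpace (LinearMap.range (defectOp A).toLinearMap).topologicalClosure)

theorem defectOp_mem (A : X →L[ℂ] Y) (x : X) : defectOp A x ∈ defectSpace A :=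
  Submodule.le_topologicalClosure _ ⟨x, rfl⟩

theorem defectOp_mul_self {A : X →L[ℂ] Y} (hA : ‖A‖ ≤ 1) (x : X) :
    defectOp A (defectOp A x) = x - (A†) (A x) := by
  have h0 : (0 : X →L[ℂ] X) ≤ 1 - A† ∘L A := by
    rw [ContinuousLinearMap.nonneg_iff_isPositive, ContinuousLinearMap.isPositive_def']
    refine ⟨?_, fun x => ?_⟩
    · rw [IsSelfAdjoint, star_sub, star_one, ContinuousLinearMap.star_eq_adjoint,
        ContinuousLinearMap.adjoint_comp, ContinuousLinearMap.adjoint_adjoint]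
    · have h2 : ‖A x‖ ≤ ‖x‖ := by
        simpa using (A.le_opNorm x).trans (mul_le_mul_of_nonneg_right hA (norm_nonneg x))
      have h3 : (1 - A† ∘L A).reApplyInnerSelf x = ‖x‖ ^ 2 - ‖A x‖ ^ 2 := by
        simp [ContinuousLinearMap.reApplyInnerSelf_apply, inner_sub_left,
          ContinuousLinearMap.adjoint_inner_left]
        norm_cast
      rw [h3]
      nlinarith [norm_nonneg (A x)]
  have := CFC.sqrt_mul_sqrt_self (1 - A† ∘L A) h0
  simpa [defectOp] using congrArg (fun S : X →L[ℂ] X => S x) this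

theorem defectOp_symm (A : X →L[ℂ] Y) (x y : X) :
    inner ℂ (defectOp A x) y = inner ℂ x (defectOp A y) := by
  have h : IsSelfAdjoint (defectOp A) := IsSelfAdjoint.of_nonneg (CFC.sqrt_nonneg _)
  conv_lhs => rw [← h.adjoint_eq, ContinuousLinearMap.adjoint_inner_left]

/-- A contraction `A` maps its defect space into the defect space of its adjoint. -/
theorem apply_mem_defectSpace {A : X →L[ℂ] Y} (hA : ‖A‖ ≤ 1) {x : X} (hx : x ∈ defectSpace A) :
    A x ∈ defectSpace (A†) := by
  have hA' : ‖A†‖ ≤ 1 := by simpa using hA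
  have key : ∀ z : X, A (defectOp A z) ∈ defectSpace (A†) := by
    intro z
    rw [defectSpace, ← Submodule.orthogonal_orthogonal_eq_closure,
      Submodule.mem_orthogonal]
    intro y hy
    rw [Submodule.mem_orthogonal] at hy
    have hy0 : defectOp (A†) y = 0 := by
      rw [← inner_self_eq_zero (𝕜 := ℂ), ← defectOp_symm]
      exact hy _ ⟨defectOp (A†) y, rfl⟩
    have h1 : y - A ((A†) y) = 0 := by
      simpa [hy0] using (defectOp_mul_self hA' y).symm
    have h2 : defectOp A (defectOp A ((A†) y)) = 0 := by
      rw [defectOp_mul_self hA, ← map_sub, h1, map_zero]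
    have h3 : defectOp A ((A†) y) = 0 := by
      rw [← inner_self_eq_zero (𝕜 := ℂ), defectOp_symm, h2, inner_zero_right]
    rw [← ContinuousLinearMap.adjoint_inner_left, ← defectOp_symm, h3, inner_zero_left]
  have hle : defectSpace A ≤ (defectSpace (A†)).comap A.toLinearMap := by
    refine Submodule.topologicalClosure_minimal _ ?_ ?_
    · rintro _ ⟨z, rfl⟩
      exact key z
    · exact (Submodule.isClosed_topologicalClosure _).preimage A.continuous
  exact hle hx

end Operators

/-! ### Noncommutative formal power series and kernels -/

/-- Formal power series `∑ S_v z^v` in `d` noncommuting indeterminates, with coefficients in the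
bounded operators from `U` to `Y`. -/
abbrev NCSeries (d : ℕ) (U : Type u) (Y : Type v)
    [NormedAddCommGroup U] [InnerProductSpace ℂ U]
    [NormedAddCommGroup Y] [InnerProductSpace ℂ Y] : Type (max u v) :=
  Word d → (U →L[ℂ] Y)

/-- Formal power series `∑ K_{α,β} z^α ζ^β` in two sets of noncommuting indeterminates, where the
`z_i` commute with the `ζ_j`. -/
abbrev NCKernel (d : ℕ) (U : Type u) (Y : Type v)
    [NormedAddCommGroup U] [InnerProductSpace ℂ U]
    [NormedAddCommGroup Y] [InnerProductSpace ℂ Y] : Type (max u v) :=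
  Word d → Word d → (U →L[ℂ] Y)

section Formal

variable {d : ℕ}
variable {U : Type u} [NormedAddCommGroup U] [InnerProductSpace ℂ U]
variable {Y : Type v} [NormedAddCommGroup Y] [InnerProductSpace ℂ Y]
variable {E : Type w} [NormedAddCommGroup E] [InnerProductSpace ℂ E]

/-- The product of formal power series in `z` and `ζ`: the coefficient of `z^α ζ^β` is the sum over
all factorizations `α = α' α''` and `β = β' β''`. -/
def NCKernel.mul (P : NCKernel d Y E) (Q : NCKernel d U Y) : NCKernel d U E := fun α β =>
  ∑ m ∈ Finset.range (α.length + 1), ∑ n ∈ Finset.range (β.length + 1),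
    P (α.take m) (β.take n) ∘L Q (α.drop m) (β.drop n)

/-- The identity operator as a constant series. -/
def NCKernel.one (d : ℕ) (U : Type u) [NormedAddCommGroup U] [InnerProductSpace ℂ U] :
    NCKernel d U U := fun α β => if α = [] ∧ β = [] then 1 else 0

/-- The indeterminate `z_k` (times the identity operator). -/
def NCKernel.zVar (U : Type u) [NormedAddCommGroup U] [InnerProductSpace ℂ U] (k : Fin d) :
    NCKernel d U U := fun α β => if α = [k] ∧ β = [] then 1 else 0

/-- The indeterminate `ζ_k` (times the identity operator). -/
def NCKernel.ζVar (U : Type u) [NormedAddCommGroup U] [InnerProductSpace ℂ U] (k : Fin d) :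
    NCKernel d U U := fun α β => if α = [] ∧ β = [k] then 1 else 0

/-- The noncommutative formal Szegő kernel `∑ z^α ζ^{αᵀ}` (times the identity operator). -/
def NCKernel.szego (d : ℕ) (U : Type u) [NormedAddCommGroup U] [InnerProductSpace ℂ U] :
    NCKernel d U U := fun α β => if β = α.reverse then 1 else 0

/-- `S(z)` as a series in `z` and `ζ`. -/
def NCSeries.inZ (S : NCSeries d U Y) : NCKernel d U Y := fun α β => if β = [] then S α else 0

/-- `S(ζ)` as a series in `z` and `ζ`. -/
def NCSeries.inζ (S : NCSeries d U Y) : NCKernel d U Y := fun α β => if α = [] then S β else 0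

variable [CompleteSpace U] [CompleteSpace Y] [CompleteSpace E]

/-- The formal adjoint `S(z)* = ∑ S_v* z^{vᵀ}`. -/
def NCSeries.star (S : NCSeries d U Y) : NCSeries d Y U := fun v => (S v.reverse)†

/-- A noncommutative kernel is positive if it has a Kolmogorov decomposition `H(z) H(ζ)*`. -/
def NCKernel.IsPositive {F : Type u} [NormedAddCommGroup F] [InnerProductSpace ℂ F]
    [CompleteSpace F] (K : NCKernel d F F) : Prop :=
  ∃ (G : Type u) (_ : NormedAddCommGroup G) (_ : InnerProductSpace ℂ G) (_ : CompleteSpace G)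
    (H : NCSeries d G F), K = NCKernel.mul H.inZ H.star.inζ

/-- The projection of `Y ⊕ U^d` onto `Y`. -/
def projY (d : ℕ) (Y : Type v) (U : Type u) [NormedAddCommGroup Y] [InnerProductSpace ℂ Y]
    [NormedAddCommGroup U] [InnerProductSpace ℂ U] : BlockSpace d Y U →L[ℂ] Y :=
  WithLp.fstL 2 ℂ Y (DirectPow d U)

/-- The projection of `Y ⊕ U^d` onto the `k`-th copy of `U`. -/
def projU (d : ℕ) (Y : Type v) (U : Type u) [NormedAddCommGroup Y] [InnerProductSpace ℂ Y]
    [NormedAddCommGroup U] [InnerProductSpace ℂ U] (k : Fin d) : BlockSpace d Y U →L[ℂ] U :=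
  coord d U k ∘L WithLp.sndL 2 ℂ Y (DirectPow d U)

/-- The `(1,1)` block of a kernel on `Y ⊕ U^d`. -/
def NCKernel.blockK (K : NCKernel d (BlockSpace d Y U) (BlockSpace d Y U)) : NCKernel d Y Y :=
  fun α β => projY d Y U ∘L K α β ∘L (projY d Y U)†

/-- The off-diagonal blocks `Ψ_k` of a kernel on `Y ⊕ U^d`. -/
def NCKernel.blockΨ (K : NCKernel d (BlockSpace d Y U) (BlockSpace d Y U)) (k : Fin d) :
    NCKernel d U Y :=
  fun α β => projY d Y U ∘L K α β ∘L (projU d Y U k)†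

/-- The blocks `Φ_{ij}` of a kernel on `Y ⊕ U^d`. -/
def NCKernel.blockΦ (K : NCKernel d (BlockSpace d Y U) (BlockSpace d Y U)) (i j : Fin d) :
    NCKernel d U U :=
  fun α β => projU d Y U i ∘L K α β ∘L (projU d Y U j)†

end Formal

/-- `K` is a noncommutative Agler decomposition for the formal power series `S`: a positive kernel
with coefficients acting on `Y ⊕ U^d` and block entries `K_S`, `Ψ_k`, `Φ_{ij}` such that
* `K_S(z,ζ) = k_Sz(z,ζ) I_Y - S(z) (k_Sz(z,ζ) I_U) S(ζ)*`,
* `S(z) - S(ζ) = ∑ k, (Ψ_k(z,ζ) z_k - ζ_k Ψ_k(z,ζ))`,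
* `I - S(z)* S(ζ) = ∑ k, Φ_{kk}(z,ζ) - ∑ i j, ζ_j Φ_{ij}(z,ζ) z_i`.
By positivity the lower left block entries are `Ψ_k(ζ,z)*`. -/
structure IsAglerDecomposition {d : ℕ}
    {U : Type u} [NormedAddCommGroup U] [InnerProductSpace ℂ U] [CompleteSpace U]
    {Y : Type u} [NormedAddCommGroup Y] [InnerProductSpace ℂ Y] [CompleteSpace Y]
    (S : NCSeries d U Y) (K : NCKernel d (BlockSpace d Y U) (BlockSpace d Y U)) : Prop where
  positive : K.IsPositive
  upper : K.blockK = NCKernel.szego d Y -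
    NCKernel.mul (NCKernel.mul S.inZ (NCKernel.szego d U)) S.star.inζ
  offDiag : S.inZ - S.inζ =
    ∑ k, (NCKernel.mul (K.blockΨ k) (NCKernel.zVar U k) -
      NCKernel.mul (NCKernel.ζVar Y k) (K.blockΨ k))
  lower : NCKernel.one d U - NCKernel.mul S.star.inZ S.inζ =
    ∑ k, K.blockΦ k k -
      ∑ i, ∑ j, NCKernel.mul (NCKernel.mul (NCKernel.ζVar U j) (K.blockΦ i j)) (NCKernel.zVar U i)

/-- Joint coincidence of two pairs `(S, K)` and `(S', K')`: there are unitary operators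
`a : Y' → Y` and `b : U' → U` with `S(z) = a S'(z) b*` and
`K(z,ζ) = (a ⊕ b ⊕ ⋯ ⊕ b) K'(z,ζ) (a ⊕ b ⊕ ⋯ ⊕ b)*`. -/
def JointlyCoincide {d : ℕ}
    {U Y : Type u} [NormedAddCommGroup U] [InnerProductSpace ℂ U]
    [NormedAddCommGroup Y] [InnerProductSpace ℂ Y]
    {U' Y' : Type v} [NormedAddCommGroup U'] [InnerProductSpace ℂ U']
    [NormedAddCommGroup Y'] [InnerProductSpace ℂ Y']
    (S : NCSeries d U Y) (K : NCKernel d (BlockSpace d Y U) (BlockSpace d Y U))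
    (S' : NCSeries d U' Y') (K' : NCKernel d (BlockSpace d Y' U') (BlockSpace d Y' U')) : Prop :=
  ∃ (a : Y' ≃ₗᵢ[ℂ] Y) (b : U' ≃ₗᵢ[ℂ] U),
    (∀ (v : Word d) (x : U), S v x = a (S' v (b.symm x))) ∧
    ∀ (α β : Word d) (x : BlockSpace d Y U),
      let W : BlockSpace d Y' U' ≃ₗᵢ[ℂ] BlockSpace d Y U :=
        LinearIsometryEquiv.withLpProdCongr 2 a
          (LinearIsometryEquiv.piLpCongrRight 2 fun _ : Fin d => b)
      K α β x = W (K' α β (W.symm x))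

/-! ### Colligations -/

/-- A structured colligation matrix `[A B; C D] : X ⊕ U → X^d ⊕ Y`. -/
structure Colligation (d : ℕ) (X : Type u) (U : Type v) (Y : Type w)
    [NormedAddCommGroup X] [InnerProductSpace ℂ X]
    [NormedAddCommGroup U] [InnerProductSpace ℂ U]
    [NormedAddCommGroup Y] [InnerProductSpace ℂ Y] where
  A : X →L[ℂ] DirectPow d X
  B : U →L[ℂ] DirectPow d X
  C : X →L[ℂ] Y
  D : U →L[ℂ] Y

namespace Colligation

variable {d : ℕ}
variable {X : Type u} [NormedAddCommGroup X] [InnerProductSpace ℂ X]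
variable {U : Type v} [NormedAddCommGroup U] [InnerProductSpace ℂ U]
variable {Y : Type w} [NormedAddCommGroup Y] [InnerProductSpace ℂ Y]

/-- The noncommutative characteristic function `D + C (I - Z(z) A)⁻¹ Z(z) B` of a colligation, where
`Z(z) = [z_1 I ⋯ z_d I]`: the constant coefficient is `D`, and the coefficient at the word `v' j` is
`C A^{v'} B_j`, where `A_j`, `B_j` are the components of `A`, `B`. -/
def charSeries (c : Colligation d X U Y) : NCSeries d U Y := fun v =>
  if h : v = [] then c.D
  else c.C ∘L wordPow (fun i => coord d X i ∘L c.A) v.dropLast ∘L coord d X (v.getLast h) ∘L c.B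

variable [CompleteSpace X] [CompleteSpace U] [CompleteSpace Y]

/-- The formal power series with coefficients from `X` to `Y ⊕ U^d` and block entries
`C (I - Z(z) A)⁻¹` and `B* (I - Z(z)* A*)⁻¹ I_k`, `k = 1, …, d`, where `I_k : X → X^d` is the
inclusion into the `k`-th slot and `Z(z)* A* = ∑ i, z_i I_i A*`. -/
def stateSeries (c : Colligation d X U Y) : NCSeries d X (BlockSpace d Y U) := fun v =>
  (projY d Y U)† ∘L c.C ∘L wordPow (fun i => coord d X i ∘L c.A) v +
    ∑ k, (projU d Y U k)† ∘L (c.B)† ∘L wordPow (fun i => (coord d X i)† ∘L (c.A)†) v ∘L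
      (coord d X k)†

/-- The kernel `G(z) G(ζ)*`, where `G` is the series `stateSeries`. -/
def kernel (c : Colligation d X U Y) : NCKernel d (BlockSpace d Y U) (BlockSpace d Y U) :=
  NCKernel.mul c.stateSeries.inZ c.stateSeries.star.inζ

end Colligation

/-! ### Row contractions -/

/-- A row contraction: a `d`-tuple of (not necessarily commuting) bounded operators on `X` whose
block row `[T_1 ⋯ T_d] : X^d → X` is a contraction. -/
structure RowContraction (d : ℕ) (X : Type u) [NormedAddCommGroup X] [InnerProductSpace ℂ X] where
  op : Fin d → X →L[ℂ] X
  norm_row_le : ‖rowOp op‖ ≤ 1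

namespace RowContraction

variable {d : ℕ}
variable {X : Type u} [NormedAddCommGroup X] [InnerProductSpace ℂ X]

/-- The block row `[T_1 ⋯ T_d] : X^d → X`. -/
def row (T : RowContraction d X) : DirectPow d X →L[ℂ] X := rowOp T.op

/-- Unitary equivalence: a single unitary operator `V` satisfies `V T_i V* = R_i` for all `i`. -/
def UnitarilyEquivalent {X' : Type v} [NormedAddCommGroup X'] [InnerProductSpace ℂ X']
    (T : RowContraction d X) (R : RowContraction d X') : Prop :=
  ∃ V : X ≃ₗᵢ[ℂ] X', ∀ (i : Fin d) (x : X'), V (T.op i (V.symm x)) = R.op i x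

variable [CompleteSpace X]

/-- A row contraction is completely nonunitary if there is no nonzero closed subspace `M`
reducing for every `T_i` such that `P_M [T_1|M ⋯ T_d|M] : M^d → M` is unitary.  (For subspaces of a
Hilbert space, `HasOrthogonalProjection` means closed.) -/
def IsCNU (T : RowContraction d X) : Prop :=
  ∀ (M : Submodule ℂ X) [M.HasOrthogonalProjection],
    (∀ i, ∀ x ∈ M, T.op i x ∈ M ∧ ((T.op i)†) x ∈ M) →
    IsUnitaryOp (rowOp fun i => M.orthogonalProjectionOnto ∘L T.op i ∘L M.subtypeL) →
    M = ⊥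

/-- The defect space of `T`, a subspace of `X^d`. -/
abbrev defectIn (T : RowContraction d X) : Submodule ℂ (DirectPow d X) := defectSpace T.row

/-- The defect space of `T*`, a subspace of `X`. -/
abbrev defectOut (T : RowContraction d X) : Submodule ℂ X := defectSpace (T.row†)

/-- The Halmos-dilation colligation `[T* D_T; D_{T*} -T] : X ⊕ 𝒟_T → X^d ⊕ 𝒟_{T*}`. -/
def halmos (T : RowContraction d X) : Colligation d X T.defectIn T.defectOut where
  A := T.row†
  B := defectOp T.row ∘L T.defectIn.subtypeL
  C := (defectOp (T.row†)).codRestrict T.defectOut (defectOp_mem _)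
  D := -(T.row ∘L T.defectIn.subtypeL).codRestrict T.defectOut
    (fun x => apply_mem_defectSpace T.norm_row_le x.2)

/-- The noncommutative characteristic function
`θ_{T,nc}(z) = (-T + D_{T*} (I - Z(z) T*)⁻¹ Z(z) D_T)|𝒟_T`. -/
def charFun (T : RowContraction d X) : NCSeries d T.defectIn T.defectOut :=
  T.halmos.charSeries

/-- The kernel `𝕂_{T,nc}` induced by the Halmos-dilation colligation of `T`. -/
def aglerKernel (T : RowContraction d X) :
    NCKernel d (BlockSpace d T.defectOut T.defectIn) (BlockSpace d T.defectOut T.defectIn) :=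
  T.halmos.kernel

end RowContraction

end NCAgler

end

/-! The Halmos matrix `[T* D_T; D_{T*} -T]` is unitary, and every assertion is a consequence of the
scalar-looking identities between its blocks `A, B, C, D`. Write A_i for the coordinates of A, so
that A_i = T_i* and A_i* = T_i, and let G_v be the coefficients of G.

Agler decomposition. Positivity is built into the definition G(z)G(ζ)*. The coefficient of Ψ_k at
(α, β) is the coefficient of the characteristic function at the word αkβ, so the formula for S(z) −
S(ζ) holds for any colligation. The other two identities are checked coefficientwise according to
whether each word is empty; each of the four cases is one block of UU* = I (for K) or of U*U = I
(for Φ). See `IsUnitary.kernel_upper` and `IsUnitary.kernel_lower`.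

Equivalence implies coincidence. A unitary V intertwining T and R intertwines the squares of the
defect operators, hence the defect operators themselves (`intertwine_of_intertwine_sq`), and so
restricts to unitaries of the defect spaces.

Coincidence implies equivalence. Equality of the kernels says that the vectors G_v* z and their
counterparts for R have the same Gram matrix. Their span is invariant under each T_i*, with the
action expressed through the coefficients of the characteristic function (`stateOp_mem_pairSpan`),
but it need not be invariant under T_i. Adjoining all translates T_w G_v* z, the relation T_i* T_j =
δ_ij − B_i* -type corrections, that is A_i A_j* = δ_ij − B_i B_j*, reduces inner products of
translates to inner products of shorter ones, so these also agree (`inner_wordPow_eq`). The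
orthogonal complement of the translates reduces T, and both defect operators vanish on it, so T is
unitary there; complete nonunitarity makes it zero (`IsCNU.halmos_isTotal`). Two total families with
the same Gram matrix are matched by a unitary, which intertwines T_i and R_i because the families
are indexed compatibly with adding a letter to w. -/

noncomputable section

namespace NCAgler

universe u v w

/-! ### Intertwining of positive square roots and of defect operators. -/

section Intertwining

variable {X : Type u} [NormedAddCommGroup X] [InnerProductSpace ℂ X] [CompleteSpace X]
variable {Y : Type v} [NormedAddCommGroup Y] [InnerProductSpace ℂ Y] [CompleteSpace Y]

theorem adjoint_apply_eq_zero_of_self_comp_adjoint {F : Type*} [NormedAddCommGroup F]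
    [InnerProductSpace ℂ F] [CompleteSpace F] (S : X →L[ℂ] F) {y : F} (h : S ((S†) y) = 0) :
    (S†) y = 0 := by
  rw [← inner_self_eq_zero (𝕜 := ℂ), ContinuousLinearMap.adjoint_inner_left, h, inner_zero_right]

/-- If `W` intertwines the squares of two positive operators, it intertwines the operators. -/
theorem intertwine_of_intertwine_sq {P : X →L[ℂ] X} {Q : Y →L[ℂ] Y} (hP : 0 ≤ P) (hQ : 0 ≤ Q)
    {W : X →L[ℂ] Y} (h : ∀ x, W (P (P x)) = Q (Q (W x))) (x : X) : W (P x) = Q (W x) := by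
  set Z : X →L[ℂ] Y := W ∘L P - Q ∘L W with hZ
  -- The hypothesis turns Q Z = Q W P − Q² W into Q W P − W P² = −Z P.
  have hQZ : ∀ x, Q (Z x) = -Z (P x) := by
    intro x
    simp [hZ, h]
  have hPs : P† = P := IsSelfAdjoint.of_nonneg hP
  have hQs : Q† = Q := IsSelfAdjoint.of_nonneg hQ
  have hq : 0 ≤ Z ∘L Z† := by
    rw [ContinuousLinearMap.nonneg_iff_isPositive]
    exact ContinuousLinearMap.isPositive_self_comp_adjoint Z
  have hR : 0 ≤ Z ∘L P ∘L Z† := by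
    rw [ContinuousLinearMap.nonneg_iff_isPositive] at hP ⊢
    exact hP.conj_adjoint Z
  have hmul : Q * (Z ∘L Z†) = -(Z ∘L P ∘L Z†) := by
    ext y
    simp [hQZ]
  have hmul' : (Z ∘L Z†) * Q = -(Z ∘L P ∘L Z†) := by
    have := congrArg (fun S : Y →L[ℂ] Y => S†) hmul
    simpa [ContinuousLinearMap.mul_def, ContinuousLinearMap.adjoint_comp, hPs, hQs,
      ContinuousLinearMap.comp_assoc] using this
  -- Commuting positive operators have a positive product, yet Q Z Z* = −Z P Z* is nonpositive; so
  -- both vanish.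
  have hcomm : Commute Q (Z ∘L Z†) := hmul.trans hmul'.symm
  have hle := Commute.mul_nonneg hQ hq hcomm
  rw [hmul] at hle
  have hzero : Z ∘L P ∘L Z† = 0 := le_antisymm (neg_nonneg.mp hle) hR
  have hPZ : ∀ y, P ((Z†) y) = 0 := by
    intro y
    have hs := CFC.sqrt_mul_sqrt_self P hP
    set s := CFC.sqrt P
    have hss : s† = s := IsSelfAdjoint.of_nonneg (CFC.sqrt_nonneg P)
    have happ : ∀ x, s (s x) = P x := fun x => congrArg (fun S : X →L[ℂ] X => S x) hs
    have h0 : s ((Z†) y) = 0 := by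
      have h1 := adjoint_apply_eq_zero_of_self_comp_adjoint (Z ∘L s) (y := y)
      rw [ContinuousLinearMap.adjoint_comp, hss] at h1
      apply h1
      simpa [happ] using congrArg (fun S : Y →L[ℂ] Y => S y) hzero
    rw [← happ, h0, map_zero]
  have hZQ : ∀ y, (Z†) (Q y) = 0 := by
    intro y
    apply adjoint_apply_eq_zero_of_self_comp_adjoint
    simpa [hzero] using congrArg (fun S : Y →L[ℂ] Y => S y) hmul'
  -- With P Z* = 0 and Z* Q = 0, expanding the middle factor gives Z* Z Z* = −Z* Q W Z* = 0, which
  -- forces Z Z* = 0 and then Z* = 0.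
  have hZ0 : ∀ y, (Z†) y = 0 := by
    intro y
    apply adjoint_apply_eq_zero_of_self_comp_adjoint
    have h3 : (Z†) (Z ((Z†) y)) = 0 := by
      have h4 : Z ((Z†) y) = W (P ((Z†) y)) - Q (W ((Z†) y)) := rfl
      rw [h4, hPZ, map_zero, zero_sub, map_neg, hZQ, neg_zero]
    have := adjoint_apply_eq_zero_of_self_comp_adjoint (Z†) (y := (Z†) y)
    rw [ContinuousLinearMap.adjoint_adjoint] at this
    exact this h3
  have : Z = 0 := by
    rw [← ContinuousLinearMap.adjoint_adjoint Z, show Z† = 0 from ContinuousLinearMap.ext hZ0,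
      map_zero]
  simpa [hZ, sub_eq_zero] using congrArg (fun S : X →L[ℂ] Y => S x) this

theorem defectOp_nonneg (A : X →L[ℂ] Y) : 0 ≤ defectOp A := CFC.sqrt_nonneg _

theorem adjoint_norm_le {A : X →L[ℂ] Y} (hA : ‖A‖ ≤ 1) : ‖A†‖ ≤ 1 := by
  simpa using hA

theorem defectOp_adjoint_mul_self {A : X →L[ℂ] Y} (hA : ‖A‖ ≤ 1) (y : Y) :
    defectOp (A†) (defectOp (A†) y) = y - A ((A†) y) := by
  simpa using defectOp_mul_self (adjoint_norm_le hA) y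

/-- The intertwining relation `A D_A = D_{A*} A`. -/
theorem apply_defectOp {A : X →L[ℂ] Y} (hA : ‖A‖ ≤ 1) (x : X) :
    A (defectOp A x) = defectOp (A†) (A x) :=
  intertwine_of_intertwine_sq (defectOp_nonneg _) (defectOp_nonneg _)
    (fun x => by rw [defectOp_mul_self hA, defectOp_adjoint_mul_self hA, map_sub]) x

/-- An intertwiner of two contractions and of their adjoints intertwines the defect operators. -/
theorem map_defectOp {X' : Type w} [NormedAddCommGroup X'] [InnerProductSpace ℂ X']
    [CompleteSpace X'] {Y' : Type*} [NormedAddCommGroup Y'] [InnerProductSpace ℂ Y']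
    [CompleteSpace Y'] {A : X →L[ℂ] Y} (hA : ‖A‖ ≤ 1) {A' : X' →L[ℂ] Y'} (hA' : ‖A'‖ ≤ 1)
    (W : X →L[ℂ] X') (h : ∀ x, W ((A†) (A x)) = (A'†) (A' (W x))) (x : X) :
    W (defectOp A x) = defectOp A' (W x) :=
  intertwine_of_intertwine_sq (defectOp_nonneg _) (defectOp_nonneg _)
    (fun x => by rw [defectOp_mul_self hA, defectOp_mul_self hA', map_sub, h]) x

end Intertwining

/-! ### Coordinates, block projections and operator words. -/

section Coordinates

variable {d : ℕ}
variable {X : Type u} [NormedAddCommGroup X] [InnerProductSpace ℂ X]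
variable {Y : Type v} [NormedAddCommGroup Y] [InnerProductSpace ℂ Y]

@[simp] theorem coord_apply (i : Fin d) (x : DirectPow d X) : coord d X i x = x i := rfl

theorem rowOp_apply (A : Fin d → X →L[ℂ] Y) (x : DirectPow d X) :
    rowOp A x = ∑ i, A i (x i) := by
  simp [rowOp]

@[simp] theorem projY_apply (x : BlockSpace d Y X) : projY d Y X x = x.fst := rfl

@[simp] theorem projU_apply (k : Fin d) (x : BlockSpace d Y X) : projU d Y X k x = x.snd k := rfl

theorem wordPow_nil (M : Fin d → X →L[ℂ] X) : wordPow M [] = 1 := rfl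

theorem wordPow_cons (M : Fin d → X →L[ℂ] X) (i : Fin d) (v : Word d) :
    wordPow M (i :: v) = M i ∘L wordPow M v := rfl

theorem wordPow_append (M : Fin d → X →L[ℂ] X) (v w : Word d) :
    wordPow M (v ++ w) = wordPow M v ∘L wordPow M w := by
  simp [wordPow, ContinuousLinearMap.mul_def]

variable [CompleteSpace X] [CompleteSpace Y]

theorem coord_adjoint_apply (i : Fin d) (x : X) :
    ((coord d X i)†) x = PiLp.single 2 i x := by
  refine ext_inner_right ℂ fun y => ?_
  rw [ContinuousLinearMap.adjoint_inner_left, coord_apply, PiLp.inner_apply,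
    Finset.sum_eq_single i]
  · simp
  · intro j _ hj
    simp [hj]
  · simp

theorem coord_coord_adjoint (i j : Fin d) (x : X) :
    (((coord d X j)†) x) i = if i = j then x else 0 := by
  rw [coord_adjoint_apply]
  by_cases h : i = j
  · subst h; simp
  · simp [h]

theorem sum_coord_adjoint_coord (x : DirectPow d X) : ∑ i, ((coord d X i)†) (x i) = x := by
  ext j
  simp [coord_coord_adjoint]

theorem projY_adjoint_apply (y : Y) :
    ((projY d Y X)†) y = WithLp.toLp 2 (y, 0) := by
  refine ext_inner_right ℂ fun z => ?_
  rw [ContinuousLinearMap.adjoint_inner_left, projY_apply, WithLp.prod_inner_apply]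
  simp

theorem projU_adjoint_apply (k : Fin d) (x : X) :
    ((projU d Y X k)†) x = WithLp.toLp 2 (0, ((coord d X k)†) x) := by
  refine ext_inner_right ℂ fun z => ?_
  rw [ContinuousLinearMap.adjoint_inner_left, projU_apply, WithLp.prod_inner_apply]
  simp [ContinuousLinearMap.adjoint_inner_left]

theorem sum_proj_adjoint_proj (x : BlockSpace d Y X) :
    ((projY d Y X)†) x.fst + ∑ k, ((projU d Y X k)†) (x.snd k) = x := by
  simp only [projY_adjoint_apply, projU_adjoint_apply]
  have h : ∑ k, (WithLp.toLp 2 ((0 : Y), ((coord d X k)†) (x.snd k)) : BlockSpace d Y X) =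
      WithLp.toLp 2 (0, x.snd) := by
    conv_rhs => rw [← sum_coord_adjoint_coord x.snd]
    rw [← WithLp.toLp_sum]
    congr 1
    ext1
    · simp [Prod.fst_sum]
    · simp [Prod.snd_sum]
  rw [h, ← WithLp.toLp_add, Prod.mk_add_mk, add_zero, zero_add]
  rfl

theorem wordPow_adjoint (M : Fin d → X →L[ℂ] X) (v : Word d) :
    (wordPow M v)† = wordPow (fun i => (M i)†) v.reverse := by
  induction v with
  | nil => exact ContinuousLinearMap.adjoint_id
  | cons i v ih =>
    rw [wordPow_cons, ContinuousLinearMap.adjoint_comp, ih, List.reverse_cons, wordPow_append]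
    rfl

end Coordinates

/-! ### Unitary colligations. -/

namespace Colligation

variable {d : ℕ}
variable {X : Type u} [NormedAddCommGroup X] [InnerProductSpace ℂ X] [CompleteSpace X]
variable {U : Type v} [NormedAddCommGroup U] [InnerProductSpace ℂ U] [CompleteSpace U]
variable {Y : Type w} [NormedAddCommGroup Y] [InnerProductSpace ℂ Y] [CompleteSpace Y]

/-- The colligation matrix `[A B; C D]` is unitary. -/
structure IsUnitary (c : Colligation d X U Y) : Prop where
  AA_add_BB : ∀ x, c.A ((c.A†) x) + c.B ((c.B†) x) = x
  CA_add_DB : ∀ x, c.C ((c.A†) x) + c.D ((c.B†) x) = 0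
  CC_add_DD : ∀ y, c.C ((c.C†) y) + c.D ((c.D†) y) = y
  adj_AA_add_CC : ∀ x, (c.A†) (c.A x) + (c.C†) (c.C x) = x
  adj_AB_add_CD : ∀ u, (c.A†) (c.B u) + (c.C†) (c.D u) = 0
  adj_BB_add_DD : ∀ u, (c.B†) (c.B u) + (c.D†) (c.D u) = u

variable {c : Colligation d X U Y}

theorem IsUnitary.AC_add_BD (hc : c.IsUnitary) (y : Y) :
    c.A ((c.C†) y) + c.B ((c.D†) y) = 0 := by
  refine ext_inner_right ℂ fun x => ?_
  rw [inner_add_left, ← ContinuousLinearMap.adjoint_inner_right c.A,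
    ← ContinuousLinearMap.adjoint_inner_right c.B, ContinuousLinearMap.adjoint_inner_left,
    ContinuousLinearMap.adjoint_inner_left, ← inner_add_right, hc.CA_add_DB]
  simp

theorem IsUnitary.adj_BA_add_DC (hc : c.IsUnitary) (x : X) :
    (c.B†) (c.A x) + (c.D†) (c.C x) = 0 := by
  refine ext_inner_right ℂ fun u => ?_
  rw [inner_add_left, ContinuousLinearMap.adjoint_inner_left,
    ContinuousLinearMap.adjoint_inner_left, ← ContinuousLinearMap.adjoint_inner_right c.A,
    ← ContinuousLinearMap.adjoint_inner_right c.C, ← inner_add_right, hc.adj_AB_add_CD]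
  simp

end Colligation

/-! ### The Halmos colligation of a row contraction is unitary. -/

namespace RowContraction

variable {d : ℕ}
variable {X : Type u} [NormedAddCommGroup X] [InnerProductSpace ℂ X] [CompleteSpace X]
variable (T : RowContraction d X)

omit [CompleteSpace X] in
theorem row_norm_le : ‖T.row‖ ≤ 1 := T.norm_row_le

theorem halmos_adjoint_A : (T.halmos.A)† = T.row := ContinuousLinearMap.adjoint_adjoint _

/-- This is the dictionary between colligation and tuple: words in the state operators are words in
the T_i*. -/
theorem coord_halmos_A (i : Fin d) : coord d X i ∘L T.halmos.A = (T.op i)† := by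
  rw [← ContinuousLinearMap.adjoint_adjoint (coord d X i ∘L T.halmos.A),
    ContinuousLinearMap.adjoint_comp, halmos_adjoint_A]
  congr 1
  ext x
  simp [row, rowOp_apply, coord_coord_adjoint, apply_ite]

theorem halmos_B_apply (u : T.defectIn) : T.halmos.B u = defectOp T.row u := rfl

theorem coe_halmos_C_apply (x : X) : (T.halmos.C x : X) = defectOp (T.row†) x := rfl

theorem coe_halmos_D_apply (u : T.defectIn) : (T.halmos.D u : X) = -T.row u := rfl

theorem halmos_adjoint_B_apply (x : DirectPow d X) :
    ((T.halmos.B)†) x = ⟨defectOp T.row x, defectOp_mem _ _⟩ := by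
  refine ext_inner_right ℂ fun u => ?_
  rw [ContinuousLinearMap.adjoint_inner_left, halmos_B_apply, Submodule.coe_inner, defectOp_symm]

theorem halmos_adjoint_C_apply (y : T.defectOut) :
    ((T.halmos.C)†) y = defectOp (T.row†) (y : X) := by
  refine ext_inner_right ℂ fun x => ?_
  rw [ContinuousLinearMap.adjoint_inner_left, Submodule.coe_inner, coe_halmos_C_apply,
    defectOp_symm]

theorem adjoint_row_mem (y : T.defectOut) : (T.row†) (y : X) ∈ T.defectIn := by
  have := apply_mem_defectSpace (adjoint_norm_le T.row_norm_le) y.2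
  rwa [ContinuousLinearMap.adjoint_adjoint] at this

theorem halmos_adjoint_D_apply (y : T.defectOut) :
    ((T.halmos.D)†) y = -⟨(T.row†) (y : X), T.adjoint_row_mem y⟩ := by
  refine ext_inner_right ℂ fun u => ?_
  rw [ContinuousLinearMap.adjoint_inner_left, Submodule.coe_inner, Submodule.coe_inner,
    coe_halmos_D_apply]
  simp [ContinuousLinearMap.adjoint_inner_left]

/-- The diagonal relations are D_T² = I − T*T and D_{T*}² = I − TT*; the off-diagonal ones are T D_T
= D_{T*} T. -/
theorem halmos_isUnitary : T.halmos.IsUnitary where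
  AA_add_BB x := by
    rw [halmos_adjoint_A, halmos_adjoint_B_apply, halmos_B_apply, defectOp_mul_self T.row_norm_le]
    exact add_sub_cancel _ _
  CA_add_DB x := by
    ext
    rw [Submodule.coe_add, halmos_adjoint_A, halmos_adjoint_B_apply, coe_halmos_D_apply,
      coe_halmos_C_apply, apply_defectOp T.row_norm_le]
    simp
  CC_add_DD y := by
    ext
    rw [Submodule.coe_add, halmos_adjoint_C_apply, halmos_adjoint_D_apply, coe_halmos_D_apply,
      coe_halmos_C_apply, defectOp_adjoint_mul_self T.row_norm_le]
    simp
  adj_AA_add_CC x := by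
    rw [halmos_adjoint_A, halmos_adjoint_C_apply, coe_halmos_C_apply,
      defectOp_adjoint_mul_self T.row_norm_le]
    exact add_sub_cancel _ _
  adj_AB_add_CD u := by
    rw [halmos_adjoint_A, halmos_adjoint_C_apply, coe_halmos_D_apply, halmos_B_apply,
      apply_defectOp T.row_norm_le]
    simp
  adj_BB_add_DD u := by
    ext1
    rw [Submodule.coe_add, halmos_adjoint_B_apply, halmos_adjoint_D_apply, halmos_B_apply]
    simp [coe_halmos_D_apply, defectOp_mul_self T.row_norm_le]

end RowContraction

/-! ### Coefficients of products with series, variables and the Szegő kernel. -/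

section Products

variable {d : ℕ}
variable {U : Type u} [NormedAddCommGroup U] [InnerProductSpace ℂ U]
variable {Y : Type v} [NormedAddCommGroup Y] [InnerProductSpace ℂ Y]
variable {E : Type w} [NormedAddCommGroup E] [InnerProductSpace ℂ E]

theorem NCKernel.mul_inZ_left (S : NCSeries d Y E) (Q : NCKernel d U Y) (α β : Word d) :
    NCKernel.mul S.inZ Q α β =
      ∑ m ∈ Finset.range (α.length + 1), S (α.take m) ∘L Q (α.drop m) β := by
  refine Finset.sum_congr rfl fun m _ => ?_
  rw [Finset.sum_eq_single 0]
  · simp [NCSeries.inZ]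
  · intro n hn hn0
    have : β.take n ≠ [] := by
      cases β with
      | nil => simp at hn; omega
      | cons j β => simp [hn0]
    simp [NCSeries.inZ, this]
  · simp

theorem NCKernel.mul_inζ_right (P : NCKernel d Y E) (S : NCSeries d U Y) (α β : Word d) :
    NCKernel.mul P S.inζ α β =
      ∑ n ∈ Finset.range (β.length + 1), P α (β.take n) ∘L S (β.drop n) := by
  unfold NCKernel.mul
  rw [Finset.sum_eq_single α.length]
  · simp [NCSeries.inζ]
  · intro m hm hm0
    have : α.drop m ≠ [] := by
      simp at hm ⊢
      omega
    simp [NCSeries.inζ, this]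
  · simp

theorem NCKernel.mul_inZ_inζ (P : NCSeries d Y E) (Q : NCSeries d U Y) (α β : Word d) :
    NCKernel.mul P.inZ Q.inζ α β = P α ∘L Q β := by
  rw [NCKernel.mul_inZ_left, Finset.sum_eq_single α.length]
  · simp [NCSeries.inζ]
  · intro m hm hm0
    have : α.drop m ≠ [] := by
      simp at hm ⊢
      omega
    simp [NCSeries.inζ, this]
  · simp

theorem NCKernel.mul_zVar_nil (P : NCKernel d U Y) (k : Fin d) (β : Word d) :
    NCKernel.mul P (NCKernel.zVar U k) [] β = 0 := by
  simp [NCKernel.mul, NCKernel.zVar]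

theorem NCKernel.mul_zVar_append (P : NCKernel d U Y) (k i : Fin d) (α β : Word d) :
    NCKernel.mul P (NCKernel.zVar U k) (α ++ [i]) β = if i = k then P α β else 0 := by
  unfold NCKernel.mul
  rw [Finset.sum_eq_single α.length]
  · rw [Finset.sum_eq_single β.length]
    · by_cases h : i = k <;> simp [NCKernel.zVar, h, ContinuousLinearMap.one_def]
    · intro n hn hn0
      have : β.drop n ≠ [] := by
        simp at hn ⊢
        omega
      simp [NCKernel.zVar, this]
    · simp
  · intro m hm hm0
    have : (α ++ [i]).drop m ≠ [k] := by
      intro h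
      have := congrArg List.length h
      simp at this
      omega
    simp [NCKernel.zVar, this]
  · simp

theorem NCKernel.ζVar_mul_nil (P : NCKernel d U Y) (k : Fin d) (α : Word d) :
    NCKernel.mul (NCKernel.ζVar Y k) P α [] = 0 := by
  simp [NCKernel.mul, NCKernel.ζVar]

theorem NCKernel.ζVar_mul_cons (P : NCKernel d U Y) (k j : Fin d) (α β : Word d) :
    NCKernel.mul (NCKernel.ζVar Y k) P α (j :: β) = if j = k then P α β else 0 := by
  unfold NCKernel.mul
  rw [Finset.sum_eq_single 0]
  · rw [Finset.sum_eq_single 1]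
    · by_cases h : j = k <;> simp [NCKernel.ζVar, h, ContinuousLinearMap.one_def]
    · intro n hn hn0
      have : (j :: β).take n ≠ [k] := by
        intro h
        have := congrArg List.length h
        simp at this hn
        omega
      simp [NCKernel.ζVar, this]
    · simp
  · intro m hm hm0
    have : α.take m ≠ [] := by
      cases α with
      | nil => simp at hm; omega
      | cons j α => simp [hm0]
    simp [NCKernel.ζVar, this]
  · simp

theorem NCKernel.inZ_mul_szego_nil (S : NCSeries d U Y) (α : Word d) :
    NCKernel.mul S.inZ (NCKernel.szego d U) α [] = S α := by
  rw [NCKernel.mul_inZ_left, Finset.sum_eq_single α.length]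
  · simp [NCKernel.szego, ContinuousLinearMap.one_def]
  · intro m hm hm0
    have : [] ≠ (α.drop m).reverse := by
      simp at hm ⊢
      omega
    simp only [NCKernel.szego, this, if_false, ContinuousLinearMap.comp_zero]
  · simp

theorem NCKernel.inZ_mul_szego_nil_cons (S : NCSeries d U Y) (j : Fin d) (β : Word d) :
    NCKernel.mul S.inZ (NCKernel.szego d U) [] (j :: β) = 0 := by
  simp [NCKernel.mul_inZ_left, NCKernel.szego]

/-- The Szegő kernel pairs the last letter in z with the first letter in ζ, so these cancel if
equal. The extra factorization, which takes all of `α ++ [i]`, leaves the empty word against `j ::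
β` and contributes nothing. -/
theorem NCKernel.inZ_mul_szego_append_cons (S : NCSeries d U Y) (i j : Fin d) (α β : Word d) :
    NCKernel.mul S.inZ (NCKernel.szego d U) (α ++ [i]) (j :: β) =
      if i = j then NCKernel.mul S.inZ (NCKernel.szego d U) α β else 0 := by
  rw [NCKernel.mul_inZ_left, NCKernel.mul_inZ_left, List.length_append, List.length_singleton,
    Finset.sum_range_succ]
  have h0 : NCKernel.szego d U ((α ++ [i]).drop (α.length + 1)) (j :: β) = 0 := by
    simp [NCKernel.szego]
  rw [h0, ContinuousLinearMap.comp_zero, add_zero]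
  by_cases h : i = j
  · rw [if_pos h]
    refine Finset.sum_congr rfl fun m hm => ?_
    have hm : m ≤ α.length := by simpa [Nat.lt_succ_iff] using hm
    rw [List.take_append_of_le_length hm, List.drop_append_of_le_length hm]
    simp [NCKernel.szego, h]
  · rw [if_neg h]
    refine Finset.sum_eq_zero fun m hm => ?_
    have hm : m ≤ α.length := by simpa [Nat.lt_succ_iff] using hm
    rw [List.drop_append_of_le_length hm]
    simp [NCKernel.szego, Ne.symm h]

theorem NCKernel.szego_conj_nil_right (S : NCSeries d U Y) (S' : NCSeries d E U) (α : Word d) :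
    NCKernel.mul (NCKernel.mul S.inZ (NCKernel.szego d U)) S'.inζ α [] = S α ∘L S' [] := by
  simp [NCKernel.mul_inζ_right, NCKernel.inZ_mul_szego_nil]

theorem NCKernel.szego_conj_nil_left (S : NCSeries d U Y) (S' : NCSeries d E U) (β : Word d) :
    NCKernel.mul (NCKernel.mul S.inZ (NCKernel.szego d U)) S'.inζ [] β = S [] ∘L S' β := by
  rw [NCKernel.mul_inζ_right, Finset.sum_eq_single 0]
  · simp [NCKernel.inZ_mul_szego_nil]
  · intro n hn hn0
    cases β with
    | nil => simp at hn; omega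
    | cons j β =>
      obtain ⟨n, rfl⟩ := Nat.exists_eq_succ_of_ne_zero hn0
      simp [NCKernel.inZ_mul_szego_nil_cons]
  · simp

/-- The factorizations of `j :: β` with empty prefix give the product term; in all others `j`
reaches the Szegő kernel and must cancel against `i`. This recursion drives the induction in
`IsUnitary.kernel_upper`. -/
theorem NCKernel.szego_conj_append_cons (S : NCSeries d U Y) (S' : NCSeries d E U)
    (i j : Fin d) (α β : Word d) :
    NCKernel.mul (NCKernel.mul S.inZ (NCKernel.szego d U)) S'.inζ (α ++ [i]) (j :: β) =
      S (α ++ [i]) ∘L S' (j :: β) +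
        if i = j then NCKernel.mul (NCKernel.mul S.inZ (NCKernel.szego d U)) S'.inζ α β
        else 0 := by
  rw [NCKernel.mul_inζ_right, NCKernel.mul_inζ_right, List.length_cons, Finset.sum_range_succ',
    add_comm]
  congr 1
  · simp [NCKernel.inZ_mul_szego_nil]
  · simp only [List.take_succ_cons, List.drop_succ_cons, NCKernel.inZ_mul_szego_append_cons]
    split_ifs <;> simp

theorem projY_projY_adjoint [CompleteSpace U] [CompleteSpace Y] (y : Y) :
    projY d Y U (((projY d Y U)†) y) = y := by
  simp [projY_adjoint_apply]

theorem projY_projU_adjoint [CompleteSpace U] [CompleteSpace Y] (k : Fin d) (u : U) :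
    projY d Y U (((projU d Y U k)†) u) = 0 := by
  simp [projU_adjoint_apply]

theorem projU_projY_adjoint [CompleteSpace U] [CompleteSpace Y] (k : Fin d) (y : Y) :
    projU d Y U k (((projY d Y U)†) y) = 0 := by
  simp [projY_adjoint_apply]

theorem projU_projU_adjoint [CompleteSpace U] [CompleteSpace Y] (k j : Fin d) (u : U) :
    projU d Y U k (((projU d Y U j)†) u) = if k = j then u else 0 := by
  simp [projU_adjoint_apply, coord_coord_adjoint]

end Products

/-! ### The kernel of a colligation and its Agler identities. -/

namespace Colligation

variable {d : ℕ}
variable {X : Type u} [NormedAddCommGroup X] [InnerProductSpace ℂ X]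
variable {U : Type v} [NormedAddCommGroup U] [InnerProductSpace ℂ U]
variable {Y : Type w} [NormedAddCommGroup Y] [InnerProductSpace ℂ Y]
variable (c : Colligation d X U Y)

/-- The component `A_i` of the state operator. -/
abbrev stateOp (i : Fin d) : X →L[ℂ] X := coord d X i ∘L c.A

/-- The operator `A ∘ coord_i` on `X^d`. -/
abbrev powOp (i : Fin d) : DirectPow d X →L[ℂ] DirectPow d X := c.A ∘L coord d X i

theorem charSeries_nil : c.charSeries [] = c.D := by simp [charSeries]

theorem charSeries_append (v : Word d) (j : Fin d) (u : U) :
    c.charSeries (v ++ [j]) u = c.C (wordPow c.stateOp v (c.B u j)) := by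
  simp [charSeries]

/-- A word in the A_i can be cut at any letter k: the part after k is read as a word in the
operators A ∘ coord_i on X^d, of which the k-th coordinate is then taken. -/
theorem charSeries_append_cons (α : Word d) (k : Fin d) (β : Word d) (u : U) :
    c.charSeries (α ++ k :: β) u =
      c.C (wordPow c.stateOp α ((wordPow c.powOp β (c.B u)) k)) := by
  induction β generalizing α k with
  | nil => exact c.charSeries_append α k u
  | cons i β ih =>
    have := ih (α ++ [k]) i
    rw [List.append_assoc, List.singleton_append] at this
    rw [this, wordPow_append, wordPow_cons]
    rfl

variable [CompleteSpace X] [CompleteSpace U] [CompleteSpace Y]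

theorem fst_stateSeries (v : Word d) (x : X) :
    (c.stateSeries v x).fst = c.C (wordPow c.stateOp v x) := by
  rw [← projY_apply]
  simp only [stateSeries, add_apply, sum_apply,
    ContinuousLinearMap.comp_apply, map_add, map_sum, projY_projY_adjoint, projY_projU_adjoint,
    Finset.sum_const_zero, add_zero]

theorem snd_stateSeries (v : Word d) (x : X) (k : Fin d) :
    (c.stateSeries v x).snd k =
      (c.B†) (wordPow (fun i => (c.powOp i)†) v (((coord d X k)†) x)) := by
  have : (fun i => (c.powOp i)†) = fun i => ((coord d X i)†) ∘L (c.A)† := by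
    funext i
    rw [ContinuousLinearMap.adjoint_comp]
  rw [this, ← projU_apply]
  simp only [stateSeries, add_apply, sum_apply,
    ContinuousLinearMap.comp_apply, map_add, map_sum, projU_projY_adjoint, projU_projU_adjoint,
    Finset.sum_ite_eq, Finset.mem_univ, if_true, zero_add]

theorem stateSeries_adjoint_projY (v : Word d) (y : Y) :
    ((c.stateSeries v)†) (((projY d Y U)†) y) = ((wordPow c.stateOp v)†) ((c.C†) y) := by
  refine ext_inner_right ℂ fun x => ?_
  simp only [ContinuousLinearMap.adjoint_inner_left, projY_apply, fst_stateSeries]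

/-- The reversal comes from taking adjoints of words; it cancels against the one in the formal
adjoint G(ζ)*. -/
theorem stateSeries_adjoint_projU (v : Word d) (k : Fin d) (u : U) :
    ((c.stateSeries v)†) (((projU d Y U k)†) u) = (wordPow c.powOp v.reverse (c.B u)) k := by
  refine ext_inner_right ℂ fun x => ?_
  simp only [ContinuousLinearMap.adjoint_inner_left, projU_apply, snd_stateSeries]
  rw [← coord_apply, ← ContinuousLinearMap.adjoint_inner_right (coord d X k),
    ContinuousLinearMap.adjoint_inner_right c.B, ← ContinuousLinearMap.adjoint_inner_left,
    wordPow_adjoint]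
  simp

theorem kernel_apply (α β : Word d) (x : BlockSpace d Y U) :
    c.kernel α β x = c.stateSeries α (((c.stateSeries β.reverse)†) x) := by
  rw [kernel, NCKernel.mul_inZ_inζ]
  rfl

theorem blockK_kernel_apply (α β : Word d) (y : Y) :
    c.kernel.blockK α β y =
      c.C (wordPow c.stateOp α (((wordPow c.stateOp β.reverse)†) ((c.C†) y))) := by
  simp [NCKernel.blockK, kernel_apply, stateSeries_adjoint_projY, fst_stateSeries]

theorem blockΨ_kernel (k : Fin d) (α β : Word d) :
    c.kernel.blockΨ k α β = c.charSeries (α ++ k :: β) := by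
  ext u
  simp [NCKernel.blockΨ, kernel_apply, stateSeries_adjoint_projU, fst_stateSeries,
    charSeries_append_cons]

theorem blockΦ_kernel_apply (i j : Fin d) (α β : Word d) (u : U) :
    c.kernel.blockΦ i j α β u = (c.B†) (wordPow (fun i => (c.powOp i)†) α
      (((coord d X i)†) ((wordPow c.powOp β (c.B u)) j))) := by
  simp [NCKernel.blockΦ, kernel_apply, stateSeries_adjoint_projU, snd_stateSeries]

/-- By `blockΨ_kernel`, both sums contribute the coefficient at the concatenated word `α ++ β`. They
cancel when both words are nonempty; when exactly one is empty a single term survives. -/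
theorem kernel_offDiag : c.charSeries.inZ - c.charSeries.inζ =
    ∑ k, (NCKernel.mul (c.kernel.blockΨ k) (NCKernel.zVar U k) -
      NCKernel.mul (NCKernel.ζVar Y k) (c.kernel.blockΨ k)) := by
  funext α β
  simp only [Finset.sum_apply, Pi.sub_apply, Finset.sum_sub_distrib]
  induction α using List.reverseRecOn with
  | nil =>
    cases β with
    | nil => simp [NCKernel.mul_zVar_nil, NCKernel.ζVar_mul_nil, NCSeries.inZ, NCSeries.inζ]
    | cons j β =>
      simp [NCKernel.mul_zVar_nil, NCKernel.ζVar_mul_cons, NCSeries.inZ, NCSeries.inζ,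
        blockΨ_kernel]
  | append_singleton α i _ =>
    cases β with
    | nil =>
      simp [NCKernel.mul_zVar_append, NCKernel.ζVar_mul_nil, NCSeries.inZ, NCSeries.inζ,
        blockΨ_kernel]
    | cons j β =>
      simp [NCKernel.mul_zVar_append, NCKernel.ζVar_mul_cons, NCSeries.inZ, NCSeries.inζ,
        blockΨ_kernel]

variable {c}

theorem charSeries_append_adjoint (v : Word d) (j : Fin d) (y : Y) :
    ((c.charSeries (v ++ [j]))†) y =
      (c.B†) (((coord d X j)†) (((wordPow c.stateOp v)†) ((c.C†) y))) := by
  refine ext_inner_right ℂ fun u => ?_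
  simp only [ContinuousLinearMap.adjoint_inner_left, charSeries_append, coord_apply]

omit [CompleteSpace U] [CompleteSpace Y] in
theorem wordPow_append_singleton_adjoint (v : Word d) (j : Fin d) (x : X) :
    ((wordPow c.stateOp (v ++ [j]))†) x =
      (c.A†) (((coord d X j)†) (((wordPow c.stateOp v)†) x)) := by
  rw [wordPow_append, ContinuousLinearMap.adjoint_comp, ContinuousLinearMap.comp_apply,
    wordPow_cons, wordPow_nil, ContinuousLinearMap.adjoint_comp, ContinuousLinearMap.adjoint_comp,
    ContinuousLinearMap.adjoint_one]
  rfl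

/-- With both words empty this is CC* + DD* = I; with one empty it is CA* + DB* = 0 or its adjoint.
Otherwise AA* + BB* = I in block (i, j) removes the two adjacent letters and leaves the same
identity for shorter words. -/
theorem IsUnitary.kernel_upper (hc : c.IsUnitary) (α β : Word d) (y : Y) :
    c.kernel.blockK α β y + NCKernel.mul (NCKernel.mul c.charSeries.inZ (NCKernel.szego d U))
      c.charSeries.star.inζ α β y = NCKernel.szego d Y α β y := by
  induction α using List.reverseRecOn generalizing β with
  | nil =>
    rw [NCKernel.szego_conj_nil_left, blockK_kernel_apply, ContinuousLinearMap.comp_apply,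
      NCSeries.star, charSeries_nil]
    cases β with
    | nil =>
      simpa [NCKernel.szego, wordPow_nil, ContinuousLinearMap.adjoint_one, charSeries_nil]
        using hc.CC_add_DD y
    | cons j β =>
      rw [List.reverse_cons, wordPow_append_singleton_adjoint, charSeries_append_adjoint,
        wordPow_nil, one_apply_eq_self, hc.CA_add_DB]
      simp [NCKernel.szego]
  | append_singleton α i ih =>
    cases β with
    | nil =>
      rw [NCKernel.szego_conj_nil_right, blockK_kernel_apply, ContinuousLinearMap.comp_apply,
        NCSeries.star, List.reverse_nil, charSeries_nil, wordPow_nil,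
        ContinuousLinearMap.adjoint_one, one_apply_eq_self, charSeries_append,
        wordPow_append, ContinuousLinearMap.comp_apply, ← map_add, ← map_add,
        wordPow_cons, wordPow_nil]
      have := congrArg (fun z : DirectPow d X => z i) (hc.AC_add_BD y)
      simp only [PiLp.add_apply, PiLp.zero_apply] at this
      simp [NCKernel.szego, this]
    | cons j β =>
      rw [NCKernel.szego_conj_append_cons, blockK_kernel_apply, add_apply,
        ContinuousLinearMap.comp_apply, NCSeries.star, List.reverse_cons, charSeries_append,
        charSeries_append_adjoint, wordPow_append_singleton_adjoint, wordPow_append,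
        ContinuousLinearMap.comp_apply, ← add_assoc, ← map_add, ← map_add, wordPow_cons,
        wordPow_nil]
      set x := ((wordPow c.stateOp β.reverse)†) ((c.C†) y) with hx
      have h := congrArg (fun z : DirectPow d X => z i) (hc.AA_add_BB (((coord d X j)†) x))
      simp only [PiLp.add_apply, coord_coord_adjoint] at h
      have ih := ih β
      rw [blockK_kernel_apply, ← hx] at ih
      simp only [ContinuousLinearMap.comp_apply, one_apply_eq_self, coord_apply, h]
      by_cases hij : i = j
      · simp only [hij, if_true, NCKernel.szego, List.reverse_append, List.reverse_singleton,
          List.singleton_append, List.cons.injEq, true_and] at ih ⊢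
        exact ih
      · have hij' : ¬ j = i := fun h => hij h.symm
        simp [hij, hij', NCKernel.szego]

omit [CompleteSpace U] [CompleteSpace Y] in
theorem wordPow_adjoint_powOp_append_singleton (v : Word d) (i : Fin d) (x : DirectPow d X) :
    wordPow (fun i => (c.powOp i)†) (v ++ [i]) x =
      wordPow (fun i => (c.powOp i)†) v (((coord d X i)†) ((c.A†) x)) := by
  rw [wordPow_append, ContinuousLinearMap.comp_apply, wordPow_cons, wordPow_nil,
    ContinuousLinearMap.adjoint_comp]
  rfl

omit [CompleteSpace X] [CompleteSpace U] [CompleteSpace Y] in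
theorem charSeries_cons (k : Fin d) (β : Word d) (u : U) :
    c.charSeries (k :: β) u = c.C ((wordPow c.powOp β (c.B u)) k) :=
  c.charSeries_append_cons [] k β u

theorem charSeries_cons_adjoint (k : Fin d) (β : Word d) (y : Y) :
    ((c.charSeries (k :: β))†) y =
      (c.B†) (((wordPow c.powOp β)†) (((coord d X k)†) ((c.C†) y))) := by
  refine ext_inner_right ℂ fun u => ?_
  simp only [ContinuousLinearMap.adjoint_inner_left, charSeries_cons, coord_apply]

theorem sum_blockΦ_kernel_apply (α β : Word d) (u : U) :
    ∑ k, c.kernel.blockΦ k k α β u = (c.B†) (wordPow (fun i => (c.powOp i)†) α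
      (wordPow c.powOp β (c.B u))) := by
  simp only [blockΦ_kernel_apply]
  rw [← map_sum, ← map_sum, sum_coord_adjoint_coord]

/-- The four cases are the blocks of U*U = I. No induction is needed: the subtracted double sum
already contains the term at the shortened words, so A*A + C*C = I closes the case of two nonempty
words. -/
theorem IsUnitary.kernel_lower (hc : c.IsUnitary) (α β : Word d) (u : U) :
    NCKernel.one d U α β u - ((c.charSeries α.reverse)†) (c.charSeries β u) =
    ∑ k, c.kernel.blockΦ k k α β u -
      ∑ i, ∑ j, NCKernel.mul (NCKernel.mul (NCKernel.ζVar U j) (c.kernel.blockΦ i j))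
        (NCKernel.zVar U i) α β u := by
  rw [sum_blockΦ_kernel_apply]
  induction α using List.reverseRecOn with
  | nil =>
    rw [List.reverse_nil, charSeries_nil, wordPow_nil, one_apply_eq_self]
    simp only [NCKernel.mul_zVar_nil, zero_apply, Finset.sum_const_zero,
      sub_zero]
    cases β with
    | nil =>
      rw [charSeries_nil, sub_eq_iff_eq_add]
      simpa [NCKernel.one, wordPow_nil] using (hc.adj_BB_add_DD u).symm
    | cons j β =>
      rw [charSeries_cons, wordPow_cons]
      have := hc.adj_BA_add_DC ((wordPow c.powOp β (c.B u)) j)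
      simpa [NCKernel.one, neg_eq_iff_add_eq_zero, add_comm] using this
  | append_singleton α i _ =>
    rw [wordPow_adjoint_powOp_append_singleton, List.reverse_append, List.reverse_singleton,
      List.singleton_append, charSeries_cons_adjoint, wordPow_adjoint, List.reverse_reverse]
    cases β with
    | nil =>
      rw [charSeries_nil]
      have := hc.adj_AB_add_CD u
      rw [add_eq_zero_iff_neg_eq] at this
      simp [NCKernel.one, NCKernel.mul_zVar_append, NCKernel.ζVar_mul_nil, wordPow_nil, ← this]
    | cons j β =>
      rw [charSeries_cons, wordPow_cons]
      set x := (wordPow c.powOp β (c.B u)) j with hx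
      have h := hc.adj_AA_add_CC x
      -- The factors ζ_j' and z_i' must match the first letter of the ζ-word and the last letter of
      -- the z-word, so one summand survives.
      have h2 : ∑ i', ∑ j', NCKernel.mul (NCKernel.mul (NCKernel.ζVar U j')
          (c.kernel.blockΦ i' j')) (NCKernel.zVar U i') (α ++ [i]) (j :: β) u =
          (c.B†) (wordPow (fun i => (c.powOp i)†) α (((coord d X i)†) x)) := by
        rw [Finset.sum_eq_single i, Finset.sum_eq_single j]
        · simp only [NCKernel.mul_zVar_append, NCKernel.ζVar_mul_cons, if_true,
            blockΦ_kernel_apply, hx]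
        · intro j' _ hj
          simp [NCKernel.mul_zVar_append, NCKernel.ζVar_mul_cons, hj.symm]
        · simp
        · intro i' _ hi
          simp [NCKernel.mul_zVar_append, hi.symm]
        · simp
      rw [h2, sub_eq_sub_iff_add_eq_add]
      simp only [ContinuousLinearMap.comp_apply, coord_apply, ← hx, ← map_add, h]
      simp [NCKernel.one]

end Colligation

theorem Colligation.IsUnitary.isAglerDecomposition {d : ℕ}
    {X : Type u} [NormedAddCommGroup X] [InnerProductSpace ℂ X] [CompleteSpace X]
    {U : Type u} [NormedAddCommGroup U] [InnerProductSpace ℂ U] [CompleteSpace U]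
    {Y : Type u} [NormedAddCommGroup Y] [InnerProductSpace ℂ Y] [CompleteSpace Y]
    {c : Colligation d X U Y} (hc : c.IsUnitary) :
    IsAglerDecomposition c.charSeries c.kernel where
  positive := ⟨X, _, _, ‹_›, c.stateSeries, rfl⟩
  upper := by
    funext α β
    ext y
    exact eq_sub_of_add_eq (hc.kernel_upper α β y)
  offDiag := c.kernel_offDiag
  lower := by
    funext α β
    ext u
    have := hc.kernel_lower α β u
    simpa [NCKernel.mul_inZ_inζ, NCSeries.star, Finset.sum_apply] using this

/-! ### Unitaries from equal Gram matrices. -/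

section Gram

variable {X : Type u} [NormedAddCommGroup X] [InnerProductSpace ℂ X]
variable {X' : Type v} [NormedAddCommGroup X'] [InnerProductSpace ℂ X']

theorem inner_eq_of_mem_span {s : Set (X × X')}
    (h : ∀ p ∈ s, ∀ q ∈ s, inner ℂ p.1 q.1 = inner ℂ p.2 q.2) {p q : X × X'}
    (hp : p ∈ Submodule.span ℂ s) (hq : q ∈ Submodule.span ℂ s) :
    inner ℂ p.1 q.1 = inner ℂ p.2 q.2 := by
  induction hp, hq using Submodule.span_induction₂ with
  | mem_mem p q hp hq => exact h p hp q hq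
  | zero_left => simp
  | zero_right => simp
  | add_left p q r _ _ _ h1 h2 => simp [h1, h2]
  | add_right p q r _ _ _ h1 h2 => simp [h1, h2]
  | smul_left t p q _ _ h => simp [h]
  | smul_right t p q _ _ h => simp [h]

theorem norm_eq_of_inner_self_eq {x : X} {x' : X'} (h : inner ℂ x x = inner ℂ x' x') :
    ‖x‖ = ‖x'‖ := by
  rw [inner_self_eq_norm_sq_to_K, inner_self_eq_norm_sq_to_K] at h
  have h' : ‖x‖ ^ 2 = ‖x'‖ ^ 2 := by exact_mod_cast h
  exact (sq_eq_sq₀ (norm_nonneg _) (norm_nonneg _)).mp h'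

/-- A linear isometry on a complete space whose range has trivial orthogonal complement is onto. -/
theorem surjective_of_total_range {E : Type*} [NormedAddCommGroup E] [NormedSpace ℂ E]
    [CompleteSpace E] [CompleteSpace X] (e : E →ₗᵢ[ℂ] X)
    (h : ∀ x, (∀ p, inner ℂ (e p) x = 0) → x = 0) : Function.Surjective e := by
  have hcl : IsClosed (LinearMap.range e.toLinearMap : Set X) := by
    rw [LinearMap.coe_range]
    exact e.isometry.isClosedEmbedding.isClosed_range
  have hcs : CompleteSpace (LinearMap.range e.toLinearMap) := hcl.completeSpace_coe
  have htop : LinearMap.range e.toLinearMap = ⊤ := by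
    rw [← Submodule.orthogonal_eq_bot_iff, Submodule.eq_bot_iff]
    intro x hx
    exact h x fun p => (Submodule.mem_orthogonal _ _).mp hx _ ⟨p, rfl⟩
  exact LinearMap.range_eq_top.mp htop

/-- Two total families with the same Gram matrix are unitarily equivalent. -/
theorem exists_unitary_of_gram_eq [CompleteSpace X] [CompleteSpace X'] {ι : Type*} {f : ι → X}
    {g : ι → X'} (h : ∀ i j, inner ℂ (f i) (f j) = inner ℂ (g i) (g j))
    (hf : ∀ x, (∀ i, inner ℂ (f i) x = 0) → x = 0)
    (hg : ∀ x, (∀ i, inner ℂ (g i) x = 0) → x = 0) :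
    ∃ V : X ≃ₗᵢ[ℂ] X', ∀ i, V (f i) = g i := by
  -- Γ is the graph of the unitary to be built. Its two coordinates have equal norms, so both
  -- projections are isometric even for the sup norm of the product, and totality makes them onto.
  let Γ : Submodule ℂ (X × X') :=
    (Submodule.span ℂ (Set.range fun i => (f i, g i))).topologicalClosure
  have hΓc : IsClosed (Γ : Set (X × X')) := Submodule.isClosed_topologicalClosure _
  have : CompleteSpace Γ := hΓc.completeSpace_coe
  have hmem : ∀ i, (f i, g i) ∈ Γ := fun i =>
    Submodule.le_topologicalClosure _ (Submodule.subset_span ⟨i, rfl⟩)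
  have hnorm : ∀ p ∈ Γ, ‖p.1‖ = ‖p.2‖ := by
    have hcl : IsClosed {p : X × X' | ‖p.1‖ = ‖p.2‖} :=
      isClosed_eq (by fun_prop) (by fun_prop)
    intro p hp
    refine closure_minimal (t := {p : X × X' | ‖p.1‖ = ‖p.2‖}) ?_ hcl hp
    intro q hq
    refine norm_eq_of_inner_self_eq (inner_eq_of_mem_span ?_ hq hq)
    rintro _ ⟨i, rfl⟩ _ ⟨j, rfl⟩
    exact h i j
  let e₁ : Γ →ₗᵢ[ℂ] X :=
    ⟨LinearMap.fst ℂ X X' ∘ₗ Γ.subtype, fun p => by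
      simp [Prod.norm_def, hnorm p p.2]⟩
  let e₂ : Γ →ₗᵢ[ℂ] X' :=
    ⟨LinearMap.snd ℂ X X' ∘ₗ Γ.subtype, fun p => by
      simp [Prod.norm_def, hnorm p p.2]⟩
  have h₁ : Function.Surjective e₁ := surjective_of_total_range e₁ fun x hx =>
    hf x fun i => hx ⟨_, hmem i⟩
  have h₂ : Function.Surjective e₂ := surjective_of_total_range e₂ fun x hx =>
    hg x fun i => hx ⟨_, hmem i⟩
  let E₁ := LinearIsometryEquiv.ofSurjective e₁ h₁
  let E₂ := LinearIsometryEquiv.ofSurjective e₂ h₂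
  refine ⟨E₁.symm.trans E₂, fun i => ?_⟩
  have : E₁.symm (f i) = ⟨_, hmem i⟩ := by
    rw [LinearIsometryEquiv.symm_apply_eq]
    rfl
  rw [LinearIsometryEquiv.trans_apply, this]
  rfl

end Gram

/-! ### Restricting unitary intertwiners to defect spaces. -/

section Restriction

variable {X : Type u} [NormedAddCommGroup X] [InnerProductSpace ℂ X] [CompleteSpace X]
variable {X' : Type v} [NormedAddCommGroup X'] [InnerProductSpace ℂ X'] [CompleteSpace X']
variable {Y : Type w} [NormedAddCommGroup Y] [InnerProductSpace ℂ Y] [CompleteSpace Y]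
variable {Y' : Type*} [NormedAddCommGroup Y'] [InnerProductSpace ℂ Y'] [CompleteSpace Y']

theorem mem_defectSpace_of_intertwine {A : X →L[ℂ] Y} {A' : X' →L[ℂ] Y'} (e : X →L[ℂ] X')
    (h : ∀ x, e (defectOp A x) = defectOp A' (e x)) {x : X} (hx : x ∈ defectSpace A) :
    e x ∈ defectSpace A' := by
  have hle : defectSpace A ≤ (defectSpace A').comap e.toLinearMap := by
    refine Submodule.topologicalClosure_minimal _ ?_ ?_
    · rintro _ ⟨z, rfl⟩
      change e (defectOp A z) ∈ defectSpace A'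
      rw [h]
      exact defectOp_mem A' (e z)
    · exact (Submodule.isClosed_topologicalClosure _).preimage e.continuous
  exact hle hx

/-- A unitary intertwiner of defect operators restricts to the defect spaces. -/
theorem exists_defectSpace_equiv {A : X →L[ℂ] Y} {A' : X' →L[ℂ] Y'} (e : X ≃ₗᵢ[ℂ] X')
    (h : ∀ x, e (defectOp A x) = defectOp A' (e x)) :
    ∃ b : defectSpace A ≃ₗᵢ[ℂ] defectSpace A', ∀ x, (b x : X') = e x := by
  have h' : ∀ x', e.symm (defectOp A' x') = defectOp A (e.symm x') := fun x' => by
    rw [LinearIsometryEquiv.symm_apply_eq, h, e.apply_symm_apply]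
  let f : defectSpace A →ₗᵢ[ℂ] defectSpace A' :=
    ⟨e.toLinearEquiv.toLinearMap.restrict fun x hx =>
      mem_defectSpace_of_intertwine (e : X →L[ℂ] X') h hx, fun x => e.norm_map x⟩
  refine ⟨LinearIsometryEquiv.ofSurjective f fun x' => ?_, fun x => rfl⟩
  refine ⟨⟨e.symm x', mem_defectSpace_of_intertwine (e.symm : X' →L[ℂ] X) h' x'.2⟩, ?_⟩
  ext
  exact e.apply_symm_apply _

end Restriction

/-! ### Equivalent colligations have coinciding pairs. -/

namespace Colligation

variable {d : ℕ}
variable {X : Type*} [NormedAddCommGroup X] [InnerProductSpace ℂ X]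
variable {X' : Type*} [NormedAddCommGroup X'] [InnerProductSpace ℂ X']
variable {U Y : Type u} [NormedAddCommGroup U] [InnerProductSpace ℂ U]
variable [NormedAddCommGroup Y] [InnerProductSpace ℂ Y]
variable {U' Y' : Type v} [NormedAddCommGroup U'] [InnerProductSpace ℂ U']
variable [NormedAddCommGroup Y'] [InnerProductSpace ℂ Y']

/-- The unitary operator `a ⊕ b ⊕ ⋯ ⊕ b`. -/
abbrev blockEquiv (d : ℕ) (a : Y' ≃ₗᵢ[ℂ] Y) (b : U' ≃ₗᵢ[ℂ] U) :
    BlockSpace d Y' U' ≃ₗᵢ[ℂ] BlockSpace d Y U :=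
  LinearIsometryEquiv.withLpProdCongr 2 a
    (LinearIsometryEquiv.piLpCongrRight 2 fun _ : Fin d => b)

theorem fst_blockEquiv_symm (a : Y' ≃ₗᵢ[ℂ] Y) (b : U' ≃ₗᵢ[ℂ] U) (x : BlockSpace d Y U) :
    ((blockEquiv d a b).symm x).fst = a.symm x.fst := rfl

theorem snd_blockEquiv_symm (a : Y' ≃ₗᵢ[ℂ] Y) (b : U' ≃ₗᵢ[ℂ] U) (x : BlockSpace d Y U)
    (k : Fin d) : ((blockEquiv d a b).symm x).snd k = b.symm (x.snd k) := rfl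

theorem fst_blockEquiv (a : Y' ≃ₗᵢ[ℂ] Y) (b : U' ≃ₗᵢ[ℂ] U) (x : BlockSpace d Y' U') :
    (blockEquiv d a b x).fst = a x.fst := rfl

theorem snd_blockEquiv (a : Y' ≃ₗᵢ[ℂ] Y) (b : U' ≃ₗᵢ[ℂ] U) (x : BlockSpace d Y' U')
    (k : Fin d) : (blockEquiv d a b x).snd k = b (x.snd k) := rfl

theorem wordPow_intertwine {M : Fin d → X →L[ℂ] X} {M' : Fin d → X' →L[ℂ] X'} (f : X → X')
    (h : ∀ i x, f (M i x) = M' i (f x)) (v : Word d) (x : X) :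
    f (wordPow M v x) = wordPow M' v (f x) := by
  induction v with
  | nil => rfl
  | cons i v ih => rw [wordPow_cons, wordPow_cons, ContinuousLinearMap.comp_apply, h, ih]; rfl

variable [CompleteSpace X] [CompleteSpace X'] [CompleteSpace U] [CompleteSpace Y]
  [CompleteSpace U'] [CompleteSpace Y']

/-- Unitarily equivalent colligations have jointly coinciding characteristic pairs. -/
theorem jointlyCoincide_of_intertwine {c : Colligation d X U Y} {c' : Colligation d X' U' Y'}
    (V : X ≃ₗᵢ[ℂ] X') (a : Y' ≃ₗᵢ[ℂ] Y) (b : U' ≃ₗᵢ[ℂ] U)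
    (hA : ∀ x i, V (c.A x i) = c'.A (V x) i) (hB : ∀ u i, V (c.B (b u) i) = c'.B u i)
    (hC : ∀ x, c.C x = a (c'.C (V x))) (hD : ∀ u, c.D (b u) = a (c'.D u)) :
    JointlyCoincide c.charSeries c.kernel c'.charSeries c'.kernel := by
  have hstate : ∀ v x, V (wordPow c.stateOp v x) = wordPow c'.stateOp v (V x) :=
    wordPow_intertwine V fun i x => hA x i
  have hpow : ∀ v x, LinearIsometryEquiv.piLpCongrRight 2 (fun _ : Fin d => V)
      (wordPow c.powOp v x) = wordPow c'.powOp v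
        (LinearIsometryEquiv.piLpCongrRight 2 (fun _ : Fin d => V) x) :=
    wordPow_intertwine _ fun i x => by
      ext k
      exact hA (x i) k
  have hBV : ∀ u, LinearIsometryEquiv.piLpCongrRight 2 (fun _ : Fin d => V) (c.B (b u)) =
      c'.B u := fun u => by
    ext k
    exact hB u k
  -- Everything about the kernels follows from G = (a ⊕ b ⊕ ⋯ ⊕ b) G' V, since V then cancels in
  -- G(z)G(ζ)*. The lower blocks are compared by testing against vectors `b u`, because the
  -- intertwining hypothesis concerns B rather than B*.
  have hH : ∀ v x, c.stateSeries v x = blockEquiv d a b (c'.stateSeries v (V x)) := by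
    intro v x
    have hfst : (c.stateSeries v x).fst = (blockEquiv d a b (c'.stateSeries v (V x))).fst := by
      rw [fst_blockEquiv, fst_stateSeries, fst_stateSeries, hC, hstate]
    have hsnd : ∀ k, (c.stateSeries v x).snd k =
        (blockEquiv d a b (c'.stateSeries v (V x))).snd k := by
      intro k
      rw [snd_blockEquiv]
      refine ext_inner_left ℂ fun u => ?_
      obtain ⟨u, rfl⟩ := b.surjective u
      rw [b.inner_map_map, ← projU_apply, ← projU_apply,
        ← ContinuousLinearMap.adjoint_inner_left (projU d Y U k),
        ← ContinuousLinearMap.adjoint_inner_left (projU d Y' U' k),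
        ← ContinuousLinearMap.adjoint_inner_left (c.stateSeries v),
        ← ContinuousLinearMap.adjoint_inner_left (c'.stateSeries v),
        stateSeries_adjoint_projU, stateSeries_adjoint_projU, ← V.inner_map_map]
      have := congrArg (fun z : DirectPow d X' => z k) (hpow v.reverse (c.B (b u)))
      rw [hBV] at this
      rw [← this]
      rfl
    rw [← sum_proj_adjoint_proj (c.stateSeries v x), hfst]
    simp only [hsnd]
    exact sum_proj_adjoint_proj _
  refine ⟨a, b, ?_, ?_⟩
  · intro v u
    obtain ⟨u, rfl⟩ := b.surjective u
    rw [b.symm_apply_apply]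
    induction v using List.reverseRecOn with
    | nil => rw [charSeries_nil, charSeries_nil, hD]
    | append_singleton v j _ => rw [charSeries_append, charSeries_append, hC, hstate, hB]
  · intro α β x
    change c.kernel α β x = blockEquiv d a b (c'.kernel α β ((blockEquiv d a b).symm x))
    rw [kernel_apply, kernel_apply, hH]
    congr 2
    refine ext_inner_right ℂ fun z' => ?_
    obtain ⟨z, rfl⟩ := V.surjective z'
    rw [V.inner_map_map, ContinuousLinearMap.adjoint_inner_left,
      ContinuousLinearMap.adjoint_inner_left, hH,
      ← (blockEquiv d a b).inner_map_map ((blockEquiv d a b).symm x),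
      LinearIsometryEquiv.apply_symm_apply]

end Colligation

/-! ### Unitary equivalence implies joint coincidence. -/

namespace RowContraction

variable {d : ℕ}
variable {X : Type u} [NormedAddCommGroup X] [InnerProductSpace ℂ X] [CompleteSpace X]
variable {X' : Type v} [NormedAddCommGroup X'] [InnerProductSpace ℂ X'] [CompleteSpace X']

theorem UnitarilyEquivalent.jointlyCoincide {T : RowContraction d X} {R : RowContraction d X'}
    (h : T.UnitarilyEquivalent R) :
    JointlyCoincide T.charFun T.aglerKernel R.charFun R.aglerKernel := by
  obtain ⟨V, hV⟩ := h
  let Vd := LinearIsometryEquiv.piLpCongrRight 2 (fun _ : Fin d => V)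
  have hop : ∀ i x, V (T.op i x) = R.op i (V x) := fun i x => by
    rw [← hV, V.symm_apply_apply]
  have hrow : ∀ x, V (T.row x) = R.row (Vd x) := fun x => by
    rw [row, row, rowOp_apply, rowOp_apply, map_sum]
    exact Finset.sum_congr rfl fun i _ => hop i _
  have hadj : ∀ x, Vd ((T.row†) x) = (R.row†) (V x) := fun x => by
    refine ext_inner_right ℂ fun z' => ?_
    obtain ⟨z, rfl⟩ := Vd.surjective z'
    rw [Vd.inner_map_map, ContinuousLinearMap.adjoint_inner_left,
      ContinuousLinearMap.adjoint_inner_left, ← hrow, V.inner_map_map]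
  have hdef : ∀ x, Vd (defectOp T.row x) = defectOp R.row (Vd x) :=
    map_defectOp T.row_norm_le R.row_norm_le (Vd : DirectPow d X →L[ℂ] DirectPow d X')
      fun x => (hadj _).trans (by rw [hrow]; rfl)
  have hdef' : ∀ x, V (defectOp (T.row†) x) = defectOp (R.row†) (V x) :=
    map_defectOp (adjoint_norm_le T.row_norm_le) (adjoint_norm_le R.row_norm_le)
      (V : X →L[ℂ] X') fun x => by
        rw [ContinuousLinearMap.adjoint_adjoint, ContinuousLinearMap.adjoint_adjoint]
        exact (hrow _).trans (by rw [hadj]; rfl)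
  obtain ⟨b, hb⟩ := exists_defectSpace_equiv Vd hdef
  obtain ⟨a, ha⟩ := exists_defectSpace_equiv V hdef'
  refine Colligation.jointlyCoincide_of_intertwine V a.symm b.symm ?_ ?_ ?_ ?_
  · intro x i
    exact congrArg (fun z : DirectPow d X' => z i) (hadj x)
  · intro u i
    have := congrArg (fun z : DirectPow d X' => z i) (hdef (b.symm u))
    rw [← hb, b.apply_symm_apply] at this
    exact this
  · intro x
    rw [LinearIsometryEquiv.eq_symm_apply]
    ext
    rw [ha, coe_halmos_C_apply, coe_halmos_C_apply, hdef']
  · intro u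
    rw [LinearIsometryEquiv.eq_symm_apply]
    ext
    rw [ha, coe_halmos_D_apply, coe_halmos_D_apply, map_neg, hrow, ← hb, b.apply_symm_apply]

end RowContraction

/-! ### Reconstructing the state operators from the characteristic pair. -/

namespace Colligation

section Single

variable {d : ℕ}
variable {X : Type*} [NormedAddCommGroup X] [InnerProductSpace ℂ X] [CompleteSpace X]
variable {U Y : Type u} [NormedAddCommGroup U] [InnerProductSpace ℂ U] [CompleteSpace U]
variable [NormedAddCommGroup Y] [InnerProductSpace ℂ Y] [CompleteSpace Y]
variable {c : Colligation d X U Y}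

theorem stateSeries_adjoint_apply (v : Word d) (z : BlockSpace d Y U) :
    ((c.stateSeries v)†) z = ((wordPow c.stateOp v)†) ((c.C†) z.fst) +
      ∑ k, (wordPow c.powOp v.reverse (c.B (z.snd k))) k := by
  conv_lhs => rw [← sum_proj_adjoint_proj z]
  rw [map_add, map_sum, stateSeries_adjoint_projY]
  simp only [stateSeries_adjoint_projU]

theorem B_apply_eq_stateSeries_adjoint (u : U) (i : Fin d) :
    c.B u i = ((c.stateSeries [])†) (((projU d Y U i)†) u) := by
  rw [stateSeries_adjoint_projU]
  rfl

/-- On the lower blocks the state operator only lengthens the word: the old slot index k becomes a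
letter and i becomes the new slot. -/
theorem stateOp_powOp_apply (i k : Fin d) (v : Word d) (u : U) :
    c.stateOp i ((wordPow c.powOp v.reverse (c.B u)) k) =
      ((c.stateSeries (v ++ [k]))†) (((projU d Y U i)†) u) := by
  rw [stateSeries_adjoint_projU, List.reverse_append]
  rfl

theorem IsUnitary.stateOp_adjoint (hc : c.IsUnitary) (i j : Fin d) (x : X) :
    c.stateOp i (((c.stateOp j)†) x) =
      (if i = j then x else 0) - c.B ((c.B†) (((coord d X j)†) x)) i := by
  rw [← coord_coord_adjoint, ContinuousLinearMap.adjoint_comp, eq_sub_iff_add_eq]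
  exact congrArg (fun z : DirectPow d X => z i) (hc.AA_add_BB (((coord d X j)†) x))

/-- The Y-component uses AC* = −BD*, and B_i is itself a coefficient of the adjoint series at the
empty word. So the state operators preserve the span of the ranges, by a formula involving only the
characteristic function. -/
theorem IsUnitary.stateOp_stateSeries_adjoint_nil (hc : c.IsUnitary) (i : Fin d)
    (z : BlockSpace d Y U) :
    c.stateOp i (((c.stateSeries [])†) z) =
      -((c.stateSeries [])†) (((projU d Y U i)†) (((c.charSeries [])†) z.fst)) +
        ∑ k, ((c.stateSeries [k])†) (((projU d Y U i)†) (z.snd k)) := by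
  have h := congrArg (fun z : DirectPow d X => z i) (hc.AC_add_BD z.fst)
  rw [stateSeries_adjoint_apply, map_add, map_sum]
  simp only [stateOp_powOp_apply, List.nil_append]
  congr 1
  rw [wordPow_nil, ContinuousLinearMap.adjoint_one, one_apply_eq_self, charSeries_nil,
    ← B_apply_eq_stateSeries_adjoint]
  exact eq_neg_of_add_eq_zero_left h

/-- On the Y-component A_i meets A_j*, and A_i A_j* = δ_ij − B_i B_j* either shortens the word or
leaves the range of B_i, with an argument given by the adjoint coefficient of the characteristic
function. -/
theorem IsUnitary.stateOp_stateSeries_adjoint_append (hc : c.IsUnitary) (i j : Fin d)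
    (v : Word d) (z : BlockSpace d Y U) :
    c.stateOp i (((c.stateSeries (v ++ [j]))†) z) =
      (if i = j then ((c.stateSeries v)†) (((projY d Y U)†) z.fst) else 0) -
        ((c.stateSeries [])†) (((projU d Y U i)†) (((c.charSeries (v ++ [j]))†) z.fst)) +
        ∑ k, ((c.stateSeries (v ++ [j] ++ [k]))†) (((projU d Y U i)†) (z.snd k)) := by
  rw [stateSeries_adjoint_apply, map_add, map_sum]
  simp only [stateOp_powOp_apply]
  congr 1
  rw [wordPow_append_singleton_adjoint, charSeries_append_adjoint,
    ← B_apply_eq_stateSeries_adjoint, stateSeries_adjoint_projY, ← hc.stateOp_adjoint,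
    ContinuousLinearMap.adjoint_comp]
  rfl

/-- The compression of `A_j A_i*` expressed through `B`. -/
theorem IsUnitary.inner_stateOp_adjoint (hc : c.IsUnitary) (i j : Fin d) (x y : X) :
    inner ℂ (((c.stateOp i)†) x) (((c.stateOp j)†) y) =
      (if i = j then inner ℂ x y else 0) -
        inner ℂ ((c.B†) (((coord d X i)†) x)) ((c.B†) (((coord d X j)†) y)) := by
  rw [ContinuousLinearMap.adjoint_inner_left, hc.stateOp_adjoint, inner_sub_right,
    ContinuousLinearMap.adjoint_inner_left c.B, ContinuousLinearMap.adjoint_inner_left]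
  split_ifs <;> simp

/-- The translates `A_w* x` of the ranges of the coefficients of `stateSeries*` are total. -/
def IsTotal (c : Colligation d X U Y) : Prop :=
  ∀ x, (∀ (w v : Word d) (z : BlockSpace d Y U),
    inner ℂ (wordPow (fun i => (c.stateOp i)†) w (((c.stateSeries v)†) z)) x = 0) → x = 0

end Single

section Pair

variable {d : ℕ}
variable {X : Type*} [NormedAddCommGroup X] [InnerProductSpace ℂ X] [CompleteSpace X]
variable {X' : Type*} [NormedAddCommGroup X'] [InnerProductSpace ℂ X'] [CompleteSpace X']
variable {U Y : Type u} [NormedAddCommGroup U] [InnerProductSpace ℂ U] [CompleteSpace U]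
variable [NormedAddCommGroup Y] [InnerProductSpace ℂ Y] [CompleteSpace Y]
variable {U' Y' : Type v} [NormedAddCommGroup U'] [InnerProductSpace ℂ U'] [CompleteSpace U']
variable [NormedAddCommGroup Y'] [InnerProductSpace ℂ Y'] [CompleteSpace Y']
variable {c : Colligation d X U Y} {c' : Colligation d X' U' Y'}
variable {a : Y' ≃ₗᵢ[ℂ] Y} {b : U' ≃ₗᵢ[ℂ] U}

theorem blockEquiv_symm_projY_adjoint (y : Y) :
    (blockEquiv d a b).symm (((projY d Y U)†) y) = ((projY d Y' U')†) (a.symm y) := by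
  refine ext_inner_right ℂ fun z => ?_
  rw [ContinuousLinearMap.adjoint_inner_left, ← (blockEquiv d a b).inner_map_map,
    LinearIsometryEquiv.apply_symm_apply, ContinuousLinearMap.adjoint_inner_left, projY_apply,
    projY_apply, fst_blockEquiv, ← a.inner_map_map (a.symm y), a.apply_symm_apply]

theorem blockEquiv_symm_projU_adjoint (k : Fin d) (u : U) :
    (blockEquiv d a b).symm (((projU d Y U k)†) u) = ((projU d Y' U' k)†) (b.symm u) := by
  refine ext_inner_right ℂ fun z => ?_
  rw [ContinuousLinearMap.adjoint_inner_left, ← (blockEquiv d a b).inner_map_map,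
    LinearIsometryEquiv.apply_symm_apply, ContinuousLinearMap.adjoint_inner_left, projU_apply,
    projU_apply, snd_blockEquiv, ← b.inner_map_map (b.symm u), b.apply_symm_apply]

/-- The span of the pairs of corresponding vectors in the ranges of the coefficients of
`stateSeries*` of two colligations. -/
def pairSpan (c : Colligation d X U Y) (c' : Colligation d X' U' Y') (a : Y' ≃ₗᵢ[ℂ] Y)
    (b : U' ≃ₗᵢ[ℂ] U) : Submodule ℂ (X × X') :=
  Submodule.span ℂ (Set.range fun p : Word d × BlockSpace d Y U =>
    (((c.stateSeries p.1)†) p.2, ((c'.stateSeries p.1)†) ((blockEquiv d a b).symm p.2)))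

theorem mem_pairSpan (v : Word d) (z : BlockSpace d Y U) :
    (((c.stateSeries v)†) z, ((c'.stateSeries v)†) ((blockEquiv d a b).symm z)) ∈
      pairSpan c c' a b :=
  Submodule.subset_span ⟨(v, z), rfl⟩

theorem mem_pairSpan_projU (v : Word d) (k : Fin d) (u : U) :
    (((c.stateSeries v)†) (((projU d Y U k)†) u),
      ((c'.stateSeries v)†) (((projU d Y' U' k)†) (b.symm u))) ∈ pairSpan c c' a b := by
  rw [← blockEquiv_symm_projU_adjoint (a := a)]
  exact mem_pairSpan _ _

theorem mem_pairSpan_projY (v : Word d) (y : Y) :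
    (((c.stateSeries v)†) (((projY d Y U)†) y),
      ((c'.stateSeries v)†) (((projY d Y' U')†) (a.symm y))) ∈ pairSpan c c' a b := by
  rw [← blockEquiv_symm_projY_adjoint (b := b)]
  exact mem_pairSpan _ _

/-- The kernel coefficients G_v G_w* are exactly the Gram matrix of the generators. -/
theorem inner_eq_of_mem_pairSpan
    (hK : ∀ α β x, c.kernel α β x =
      blockEquiv d a b (c'.kernel α β ((blockEquiv d a b).symm x)))
    {p q : X × X'} (hp : p ∈ pairSpan c c' a b) (hq : q ∈ pairSpan c c' a b) :
    inner ℂ p.1 q.1 = inner ℂ p.2 q.2 := by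
  refine inner_eq_of_mem_span ?_ hp hq
  rintro _ ⟨⟨v, x⟩, rfl⟩ _ ⟨⟨w, y⟩, rfl⟩
  have h := hK v w.reverse y
  rw [kernel_apply, kernel_apply, List.reverse_reverse] at h
  simp only [ContinuousLinearMap.adjoint_inner_left]
  rw [h, ← (blockEquiv d a b).inner_map_map ((blockEquiv d a b).symm x),
    LinearIsometryEquiv.apply_symm_apply]

omit [CompleteSpace X] [CompleteSpace X'] in
theorem charSeries_adjoint_of_coincide
    (hS : ∀ v u, c.charSeries v u = a (c'.charSeries v (b.symm u))) (v : Word d) (y : Y) :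
    ((c'.charSeries v)†) (a.symm y) = b.symm (((c.charSeries v)†) y) := by
  refine ext_inner_right ℂ fun u' => ?_
  obtain ⟨u, rfl⟩ := b.symm.surjective u'
  rw [b.symm.inner_map_map, ContinuousLinearMap.adjoint_inner_left,
    ContinuousLinearMap.adjoint_inner_left, hS, ← a.inner_map_map, a.apply_symm_apply]

/-- The two formulas for A_i G_v* z have the same shape for both colligations, and `a`, `b` carry
the characteristic coefficients in one to those in the other. -/
theorem stateOp_mem_pairSpan (hc : c.IsUnitary) (hc' : c'.IsUnitary)
    (hS : ∀ v u, c.charSeries v u = a (c'.charSeries v (b.symm u))) (i : Fin d) {p : X × X'}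
    (hp : p ∈ pairSpan c c' a b) : (c.stateOp i p.1, c'.stateOp i p.2) ∈ pairSpan c c' a b := by
  have hle : pairSpan c c' a b ≤ (pairSpan c c' a b).comap
      ((c.stateOp i).toLinearMap.prodMap (c'.stateOp i).toLinearMap) := by
    refine Submodule.span_le.mpr ?_
    rintro _ ⟨⟨v, z⟩, rfl⟩
    change (c.stateOp i (((c.stateSeries v)†) z),
      c'.stateOp i (((c'.stateSeries v)†) ((blockEquiv d a b).symm z))) ∈ pairSpan c c' a b
    have hsum : ∀ v : Word d, (∑ k, ((c.stateSeries (v ++ [k]))†) (((projU d Y U i)†) (z.snd k)),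
        ∑ k, ((c'.stateSeries (v ++ [k]))†) (((projU d Y' U' i)†) (b.symm (z.snd k)))) ∈
          pairSpan c c' a b := by
      intro v
      have := Submodule.sum_mem (pairSpan c c' a b) fun k (_ : k ∈ Finset.univ) =>
        mem_pairSpan_projU (c := c) (c' := c') (a := a) (b := b) (v ++ [k]) i (z.snd k)
      convert this using 1
      exact Prod.ext (by rw [Prod.fst_sum]) (by rw [Prod.snd_sum])
    induction v using List.reverseRecOn with
    | nil =>
      rw [hc.stateOp_stateSeries_adjoint_nil, hc'.stateOp_stateSeries_adjoint_nil]
      simp only [fst_blockEquiv_symm, snd_blockEquiv_symm, charSeries_adjoint_of_coincide hS]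
      exact Submodule.add_mem _ (Submodule.neg_mem _ (mem_pairSpan_projU _ _ _)) (hsum [])
    | append_singleton v j _ =>
      have hite : (if i = j then ((c.stateSeries v)†) (((projY d Y U)†) z.fst) else 0,
          if i = j then ((c'.stateSeries v)†) (((projY d Y' U')†) (a.symm z.fst)) else 0) ∈
            pairSpan c c' a b := by
        split_ifs
        · exact mem_pairSpan_projY _ _
        · exact Submodule.zero_mem _
      rw [hc.stateOp_stateSeries_adjoint_append, hc'.stateOp_stateSeries_adjoint_append]
      simp only [fst_blockEquiv_symm, snd_blockEquiv_symm, charSeries_adjoint_of_coincide hS]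
      exact Submodule.add_mem _ (Submodule.sub_mem _ hite (mem_pairSpan_projU [] i _)) (hsum _)
  exact hle hp

theorem wordPow_stateOp_mem_pairSpan (hc : c.IsUnitary) (hc' : c'.IsUnitary)
    (hS : ∀ v u, c.charSeries v u = a (c'.charSeries v (b.symm u))) (w : Word d) {p : X × X'}
    (hp : p ∈ pairSpan c c' a b) :
    (wordPow c.stateOp w p.1, wordPow c'.stateOp w p.2) ∈ pairSpan c c' a b := by
  induction w with
  | nil => exact hp
  | cons i w ih => exact stateOp_mem_pairSpan hc hc' hS i ih

/-- If one word is empty, the other is moved across the inner product, where it acts within the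
span. If both are nonempty, `IsUnitary.inner_stateOp_adjoint` strips one letter from each at the
cost of a term in B*, which `hdef` matches. -/
theorem inner_wordPow_eq (hc : c.IsUnitary) (hc' : c'.IsUnitary)
    (hS : ∀ v u, c.charSeries v u = a (c'.charSeries v (b.symm u)))
    (hK : ∀ α β x, c.kernel α β x =
      blockEquiv d a b (c'.kernel α β ((blockEquiv d a b).symm x)))
    (w w' : Word d) {p q : X × X'} (hp : p ∈ pairSpan c c' a b) (hq : q ∈ pairSpan c c' a b) :
    inner ℂ (wordPow (fun i => (c.stateOp i)†) w p.1)
        (wordPow (fun i => (c.stateOp i)†) w' q.1) =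
      inner ℂ (wordPow (fun i => (c'.stateOp i)†) w p.2)
        (wordPow (fun i => (c'.stateOp i)†) w' q.2) := by
  have hadj : ∀ (w : Word d) {p q : X × X'}, p ∈ pairSpan c c' a b → q ∈ pairSpan c c' a b →
      inner ℂ (wordPow (fun i => (c.stateOp i)†) w p.1) q.1 =
        inner ℂ (wordPow (fun i => (c'.stateOp i)†) w p.2) q.2 := by
    intro w p q hp hq
    have := inner_eq_of_mem_pairSpan hK hp
      (wordPow_stateOp_mem_pairSpan hc hc' hS w.reverse hq)
    simpa only [← ContinuousLinearMap.adjoint_inner_left, wordPow_adjoint, List.reverse_reverse]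
      using this
  -- Testing against u moves B onto u, and the pair of vectors B_i u, B'_i b* u lies in the span; so
  -- the case of one empty word applies.
  have hdef : ∀ (i : Fin d) (w : Word d) {p : X × X'}, p ∈ pairSpan c c' a b →
      (c.B†) (((coord d X i)†) (wordPow (fun i => (c.stateOp i)†) w p.1)) =
        b ((c'.B†) (((coord d X' i)†) (wordPow (fun i => (c'.stateOp i)†) w p.2))) := by
    intro i w p hp
    refine ext_inner_right ℂ fun u => ?_
    have hu := mem_pairSpan_projU (c := c) (c' := c') (a := a) (b := b) [] i u
    rw [← B_apply_eq_stateSeries_adjoint, ← B_apply_eq_stateSeries_adjoint] at hu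
    conv_rhs => rw [← b.apply_symm_apply u, b.inner_map_map]
    simpa only [ContinuousLinearMap.adjoint_inner_left c.B,
      ContinuousLinearMap.adjoint_inner_left c'.B,
      ContinuousLinearMap.adjoint_inner_left (coord d X i),
      ContinuousLinearMap.adjoint_inner_left (coord d X' i), coord_apply] using hadj w hp hu
  induction w generalizing w' with
  | nil =>
    rw [← inner_conj_symm, ← inner_conj_symm (wordPow _ [] p.2)]
    exact congrArg _ (hadj w' hq hp)
  | cons i w ih =>
    cases w' with
    | nil => exact hadj (i :: w) hp hq
    | cons j w' =>
      simp only [wordPow_cons, ContinuousLinearMap.comp_apply]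
      rw [hc.inner_stateOp_adjoint, hc'.inner_stateOp_adjoint, ih, hdef i w hp, hdef j w' hq,
        b.inner_map_map]

/-- Total unitary colligations with jointly coinciding characteristic pairs have unitarily
equivalent state operators. -/
theorem exists_unitary_of_jointlyCoincide (hc : c.IsUnitary) (hc' : c'.IsUnitary)
    (ht : c.IsTotal) (ht' : c'.IsTotal)
    (h : JointlyCoincide c.charSeries c.kernel c'.charSeries c'.kernel) :
    ∃ V : X ≃ₗᵢ[ℂ] X', ∀ i x, V (((c.stateOp i)†) x) = ((c'.stateOp i)†) (V x) := by
  obtain ⟨a, b, hS, hK⟩ := h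
  obtain ⟨V, hV⟩ := exists_unitary_of_gram_eq
    (ι := Word d × pairSpan c c' a b)
    (f := fun i => wordPow (fun i => (c.stateOp i)†) i.1 i.2.1.1)
    (g := fun i => wordPow (fun i => (c'.stateOp i)†) i.1 i.2.1.2)
    (fun i j => inner_wordPow_eq hc hc' hS hK i.1 j.1 i.2.2 j.2.2)
    (fun x hx => ht x fun w v z => hx (w, ⟨_, mem_pairSpan v z⟩))
    (fun x hx => ht' x fun w v z => by
      have := hx (w, ⟨_, mem_pairSpan v (blockEquiv d a b z)⟩)
      simpa only [LinearIsometryEquiv.symm_apply_apply] using this)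
  refine ⟨V, fun i => ?_⟩
  let Z : X →L[ℂ] X' :=
    (V : X →L[ℂ] X') ∘L (c.stateOp i)† - (c'.stateOp i)† ∘L (V : X →L[ℂ] X')
  -- Applying the adjoint state operator to the family member at w gives the member at `i :: w`, so
  -- Z kills a total family and its adjoint vanishes.
  have hZ : ∀ y, (Z†) y = 0 := by
    refine fun y => ht _ fun w v z => ?_
    have h1 := hV (w, ⟨_, mem_pairSpan v z⟩)
    have h2 := hV (i :: w, ⟨_, mem_pairSpan v z⟩)
    have h3 : Z (wordPow (fun i => (c.stateOp i)†) w (((c.stateSeries v)†) z)) = 0 := by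
      change V _ - ((c'.stateOp i)†) (V _) = 0
      rw [sub_eq_zero]
      exact h2.trans (congrArg ((c'.stateOp i)†) h1.symm)
    rw [ContinuousLinearMap.adjoint_inner_right, h3, inner_zero_left]
  intro x
  have hx : Z x = 0 := by
    rw [← inner_self_eq_zero (𝕜 := ℂ), ← ContinuousLinearMap.adjoint_inner_right, hZ,
      inner_zero_right]
  exact sub_eq_zero.mp hx

end Pair

end Colligation

/-! ### Complete nonunitarity gives totality. -/

namespace RowContraction

variable {d : ℕ}
variable {X : Type u} [NormedAddCommGroup X] [InnerProductSpace ℂ X] [CompleteSpace X]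
variable {T : RowContraction d X}

theorem halmos_stateOp_adjoint (i : Fin d) : (T.halmos.stateOp i)† = T.op i := by
  rw [Colligation.stateOp, coord_halmos_A, ContinuousLinearMap.adjoint_adjoint]

/-- The part of a row contraction on a reducing subspace annihilated by the defect operators
is unitary. -/
theorem isUnitaryOp_compression (L : Submodule ℂ X) [L.HasOrthogonalProjection]
    (hL : ∀ i, ∀ x ∈ L, T.op i x ∈ L ∧ ((T.op i)†) x ∈ L)
    (hC : ∀ x ∈ L, T.halmos.C x = 0)
    (hB : ∀ x ∈ L, ∀ i, (T.halmos.B†) (((coord d X i)†) x) = 0) :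
    IsUnitaryOp (rowOp fun i => L.orthogonalProjectionOnto ∘L T.op i ∘L L.subtypeL) := by
  set E := rowOp fun i => L.orthogonalProjectionOnto ∘L T.op i ∘L L.subtypeL with hE
  have hcoe : ∀ x : DirectPow d L,
      (E x : X) = T.row (WithLp.toLp 2 fun i => (x i : X)) := by
    intro x
    rw [hE, rowOp_apply, row, rowOp_apply, Submodule.coe_sum]
    refine Finset.sum_congr rfl fun i _ => ?_
    exact Submodule.starProjection_eq_self_iff.mpr (hL i _ (x i).2).1
  -- On L^d the adjoint of B, hence D_T, vanishes, so T*T acts as the identity there.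
  have hnorm : ∀ x, ‖E x‖ = ‖x‖ := by
    intro x
    set y : DirectPow d X := WithLp.toLp 2 fun i => (x i : X) with hy
    have hBy : (T.halmos.B†) y = 0 := by
      rw [← sum_coord_adjoint_coord y, map_sum]
      exact Finset.sum_eq_zero fun i _ => hB _ (x i).2 i
    have hTy : (T.row†) (T.row y) = y := by
      have := T.halmos_isUnitary.AA_add_BB y
      rwa [hBy, map_zero, add_zero, halmos_adjoint_A] at this
    have h1 : ‖E x‖ = ‖T.row y‖ := by rw [← hcoe]; rfl
    have h2 : ‖T.row y‖ = ‖y‖ := norm_eq_of_inner_self_eq (by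
      rw [← ContinuousLinearMap.adjoint_inner_left, hTy])
    rw [h1, h2, PiLp.norm_eq_of_L2, PiLp.norm_eq_of_L2]
    rfl
  refine ⟨LinearIsometryEquiv.ofSurjective ⟨E.toLinearMap, hnorm⟩ fun y => ?_, fun x => rfl⟩
  -- The preimage is T* y: it lies in L^d since L is reducing, and TT* y = y because D_{T*} y = 0.
  refine ⟨WithLp.toLp 2 fun i => ⟨((T.op i)†) y, (hL i _ y.2).2⟩, ?_⟩
  ext
  have h := T.halmos_isUnitary.adj_AA_add_CC y
  rw [hC _ y.2, map_zero, add_zero, halmos_adjoint_A] at h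
  refine (hcoe _).trans (Eq.trans (congrArg T.row ?_) h)
  ext i
  exact congrArg (fun S : X →L[ℂ] X => S y) (T.coord_halmos_A i).symm

/-- The complement L of the translates reduces T. Already the empty-word coefficients of G* contain
the ranges of C* and of all B_i, so L is annihilated by both defect operators and complete
nonunitarity applies. -/
theorem IsCNU.halmos_isTotal (hT : T.IsCNU) : T.halmos.IsTotal := by
  set c := T.halmos
  let S : Set X := {x | ∃ (w v : Word d) (z : BlockSpace d T.defectOut T.defectIn),
    wordPow (fun i => (c.stateOp i)†) w (((c.stateSeries v)†) z) = x}
  let L := (Submodule.span ℂ S)ᗮ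
  have hmem : ∀ x, x ∈ L ↔ ∀ (w v : Word d) (z : BlockSpace d T.defectOut T.defectIn),
      inner ℂ (wordPow (fun i => (c.stateOp i)†) w (((c.stateSeries v)†) z)) x = 0 := by
    intro x
    constructor
    · intro hx w v z
      exact (Submodule.mem_orthogonal _ _).mp hx _ (Submodule.subset_span ⟨w, v, z, rfl⟩)
    · intro hx
      rw [Submodule.mem_orthogonal]
      intro y hy
      induction hy using Submodule.span_induction with
      | mem y hy =>
        obtain ⟨w, v, z, rfl⟩ := hy
        exact hx w v z
      | zero => exact inner_zero_left _
      | add y z _ _ hy hz => rw [inner_add_left, hy, hz, add_zero]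
      | smul t y _ hy => rw [inner_smul_left, hy, mul_zero]
  have hc : c.IsUnitary := T.halmos_isUnitary
  have hnil : ∀ x ∈ L, ∀ v z, inner ℂ (((c.stateSeries v)†) z) x = 0 :=
    fun x hx v z => (hmem x).mp hx [] v z
  have hred : ∀ i, ∀ x ∈ L, T.op i x ∈ L ∧ ((T.op i)†) x ∈ L := by
    intro i x hx
    constructor
    -- Invariance of L under T_i amounts to T_i* mapping each translate into the span: for a
    -- nonempty word by A_i A_j* = δ_ij − B_i B_j*, for the empty word by the formulas for A_i G_v*
    -- z.
    · rw [hmem]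
      intro w v z
      rw [← ContinuousLinearMap.adjoint_inner_left, ← coord_halmos_A]
      change inner ℂ (c.stateOp i _) x = 0
      cases w with
      | nil =>
        rw [wordPow_nil, one_apply_eq_self]
        induction v using List.reverseRecOn with
        | nil =>
          rw [hc.stateOp_stateSeries_adjoint_nil, inner_add_left, inner_neg_left, hnil x hx,
            sum_inner]
          simp [hnil x hx]
        | append_singleton v j _ =>
          rw [hc.stateOp_stateSeries_adjoint_append, inner_add_left, inner_sub_left, hnil x hx,
            sum_inner]
          split_ifs <;> simp [hnil x hx]
      | cons j w =>
        rw [wordPow_cons, ContinuousLinearMap.comp_apply ((c.stateOp j)†), hc.stateOp_adjoint,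
          inner_sub_left,
          Colligation.B_apply_eq_stateSeries_adjoint, hnil x hx, sub_zero]
        split_ifs
        · exact (hmem x).mp hx w v z
        · exact inner_zero_left _
    · rw [hmem]
      intro w v z
      rw [ContinuousLinearMap.adjoint_inner_right, ← halmos_stateOp_adjoint]
      exact (hmem x).mp hx (i :: w) v z
  have hC : ∀ x ∈ L, c.C x = 0 := by
    intro x hx
    have := hnil x hx [] (((projY d T.defectOut T.defectIn)†) (c.C x))
    rw [Colligation.stateSeries_adjoint_projY, ContinuousLinearMap.adjoint_inner_left,
      ContinuousLinearMap.adjoint_inner_left] at this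
    exact inner_self_eq_zero.mp this
  have hB : ∀ x ∈ L, ∀ i, (c.B†) (((coord d X i)†) x) = 0 := by
    intro x hx i
    have := hnil x hx []
      (((projU d T.defectOut T.defectIn i)†) ((c.B†) (((coord d X i)†) x)))
    rw [← Colligation.B_apply_eq_stateSeries_adjoint, ← coord_apply,
      ← ContinuousLinearMap.adjoint_inner_right, ← ContinuousLinearMap.adjoint_inner_right]
      at this
    exact inner_self_eq_zero.mp this
  have hbot : L = ⊥ := hT L hred (isUnitaryOp_compression L hred hC hB)
  intro x hx
  have hxL : x ∈ L := (hmem x).mpr hx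
  rwa [hbot, Submodule.mem_bot] at hxL

end RowContraction

end NCAgler

end

theorem mainTheorem10 {d : ℕ}
    {X : Type*} [NormedAddCommGroup X] [InnerProductSpace ℂ X] [CompleteSpace X]
    {X' : Type*} [NormedAddCommGroup X'] [InnerProductSpace ℂ X'] [CompleteSpace X']
    (T : NCAgler.RowContraction d X) (R : NCAgler.RowContraction d X')
    (hT : T.IsCNU) (hR : R.IsCNU) :
    NCAgler.IsAglerDecomposition T.charFun T.aglerKernel ∧
    NCAgler.IsAglerDecomposition R.charFun R.aglerKernel ∧
    (T.UnitarilyEquivalent R ↔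
      NCAgler.JointlyCoincide T.charFun T.aglerKernel R.charFun R.aglerKernel) := by
  refine ⟨T.halmos_isUnitary.isAglerDecomposition, R.halmos_isUnitary.isAglerDecomposition,
    fun h => h.jointlyCoincide, fun h => ?_⟩
  obtain ⟨V, hV⟩ := NCAgler.Colligation.exists_unitary_of_jointlyCoincide T.halmos_isUnitary
    R.halmos_isUnitary hT.halmos_isTotal hR.halmos_isTotal h
  refine ⟨V, fun i x => ?_⟩
  have := hV i (V.symm x)
  rwa [V.apply_symm_apply, NCAgler.RowContraction.halmos_stateOp_adjoint,
    NCAgler.RowContraction.halmos_stateOp_adjoint] at this
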